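/- Let $G$ be a nilpotent group generated by a $k$-tuple $S=(s_1,\dots,s_k)$, $k\ge 1$, and let $a=(\alpha_1,\dots,\alpha_k)\in(0,\infty]^k$. Put $$\mu_{S,a}(g)=\frac1k\sum_{i=1}^k c(\alpha_i)\sum_{m\in\mathbb Z}(1+|m|)^{-\alpha_i-1}\mathbf 1_{\{s_i^m=g\}},\qquad c(\alpha)^{-1}=\sum_{m\in\mathbb Z}(1+|m|)^{-\alpha-1},$$ where for $\alpha=\infty$ the expression $(1+|m|)^{-\alpha-1}$ means $1$ if $m\in\{-1,0,1\}$ and $0$ otherwise. Let $\mu_{S,a}^{(n)}$ be the $n$-fold convolution power and $e$ the identity of $G$. Formal commutators over $S^{\pm1}$ are the letters $s_i^{\pm1}$ and, inductively, the brackets $[c_1,c_2]$ of formal commutators $c_1,c_2$; a formal commutator has an image in $G$ through $[x,y]=x^{-1}y^{-1}xy$. A weight system $\mathfrak w$ of dimension $d$ is given by weights $w(s_i^{\pm1})=w_i\in(0,\infty)\times\mathbb R^{d-1}$ and $w([c_1,c_2])=w(c_1)+w(c_2)$, the values being ordered lexicographically. In the two cases below the values of $w$ form an increasing sequence $\bar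 w_1<\bar w_2<\cdots$. Let $G^{\mathfrak w}_h$ be the subgroup of $G$ generated by the images of all formal commutators $c$ with $w(c)\ge\bar w_h$, and let $j_*$ be the least integer with $G^{\mathfrak w}_{j_*+1}=\{e\}$. The quotients $G^{\mathfrak w}_h/G^{\mathfrak w}_{h+1}$ are abelian groups; $\operatorname{rank}$ denotes their torsion-free rank. Set $\tilde\alpha_i=\min\{2,\alpha_i\}$. (1) Let $\mathfrak w$ be the two-dimensional weight system with $w_i=(1/\tilde\alpha_i,\,1/2)$ if $\alpha_i=2$ and $w_i=(1/\tilde\alpha_i,\,0)$ otherwise. Write $\bar w_h=(\bar v_{h,1},\bar v_{h,2})$ and $D_l=\sum_{h=1}^{j_*}\bar v_{h,l}\operatorname{rank}(G^{\mathfrak w}_h/G^{\mathfrak w}_{h+1})$ for $l=1,2$. Then there is a constant $C$, depending only on $G$, $S$ and $a$, such that for all integers $n\ge1$ $$\mu_{S,a}^{(n)}(e)\le C\,n^{-D_1}\,[\log(e+n)]^{-D_2},$$ where $e$ inside the logarithm is the base of the natural logarithm. (2) Let $\mathfrak w$ be the one-dimensional weight system with $w_i=1/\tilde\alpha_i$,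 and let $D(S,\mathfrak w)=\sum_{h=1}^{j_*}\bar w_h\operatorname{rank}(G^{\mathfrak w}_h/G^{\mathfrak w}_{h+1})$. Then there is a constant $C$, depending only on $G$, $S$ and $a$, such that for all integers $n\ge1$ $$\mu_{S,a}^{(n)}(e)\le C\,n^{-D(S,\mathfrak w)}.$$ -/

import Mathlib

open scoped ENNReal

noncomputable section

namespace NilpotentWalk

/-! ### Formal commutators, their weights and their images in a group -/

/-- Formal commutators over the letters `s_1^{±1}, …, s_k^{±1}`: a letter, or a bracket
`[c₁, c₂]` of two formal commutators. -/
inductive FormalComm (k : ℕ) : Type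
  | letter (i : Fin k) (ε : ℤˣ) : FormalComm k
  | bracket (c₁ c₂ : FormalComm k) : FormalComm k

namespace FormalComm

/-- The image of a formal commutator in `G`, with the convention `[x, y] = x⁻¹ y⁻¹ x y`. -/
def eval {G : Type*} [Group G] {k : ℕ} (S : Fin k → G) : FormalComm k → G
  | letter i ε => S i ^ (ε : ℤ)
  | bracket c₁ c₂ => (c₁.eval S)⁻¹ * (c₂.eval S)⁻¹ * c₁.eval S * c₂.eval S

/-- The weight of a formal commutator: `w(s_i^{±1}) = w_i` and
`w([c₁, c₂]) = w(c₁) + w(c₂)`. -/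
def weight {Γ : Type*} [Add Γ] {k : ℕ} (w : Fin k → Γ) : FormalComm k → Γ
  | letter i _ => w i
  | bracket c₁ c₂ => c₁.weight w + c₂.weight w

end FormalComm

/-! ### The sequence of weight values and the associated filtration -/

open Classical in
/-- The least element of `A` (and `0` if there is none). -/
def leastOf {Γ : Type*} [LinearOrder Γ] [Zero Γ] (A : Set Γ) : Γ :=
  if h : ∃ x, IsLeast A x then h.choose else 0

/-- The increasing sequence of the values of the weight system generated by `w`. Indices start
at `0`, so that `wbar w j` is what is usually written `w̄_{j+1}`. -/
def wbar {Γ : Type*} [LinearOrder Γ] [AddCommGroup Γ] {k : ℕ} (w : Fin k → Γ) : ℕ → Γ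
  | 0 => leastOf (Set.range (FormalComm.weight w))
  | j + 1 => leastOf {v | v ∈ Set.range (FormalComm.weight w) ∧ wbar w j < v}

/-- The subgroup generated by the images of all formal commutators of weight at least
`wbar w j`; with the usual numbering this is `G^w_{j+1}`. -/
def filtration {G : Type*} [Group G] {Γ : Type*} [LinearOrder Γ] [AddCommGroup Γ] {k : ℕ}
    (S : Fin k → G) (w : Fin k → Γ) (j : ℕ) : Subgroup G :=
  Subgroup.closure (FormalComm.eval S '' {c | wbar w j ≤ c.weight w})

section Filtration

variable {G : Type*} [Group G] {Γ : Type*} [LinearOrder Γ] [AddCommGroup Γ]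
  [IsOrderedAddMonoid Γ] {k : ℕ} {S : Fin k → G} {w : Fin k → Γ}

theorem weight_pos (hw : ∀ i, 0 < w i) (c : FormalComm k) : 0 < c.weight w := by
  induction c with
  | letter i ε => exact hw i
  | bracket c₁ c₂ h₁ h₂ => exact add_pos h₁ h₂

theorem filtration_conj_mem (hw : ∀ i, 0 < w i) (j : ℕ) (i : Fin k) (ε : ℤˣ) {x : G}
    (hx : x ∈ filtration S w j) :
    (S i ^ (ε : ℤ))⁻¹ * x * S i ^ (ε : ℤ) ∈ filtration S w j := by
  induction hx using Subgroup.closure_induction with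
  | mem x hx =>
    obtain ⟨c, hc, rfl⟩ := hx
    have h1 : c.eval S ∈ filtration S w j := Subgroup.subset_closure ⟨c, hc, rfl⟩
    have h2 : (FormalComm.bracket c (.letter i ε)).eval S ∈ filtration S w j := by
      refine Subgroup.subset_closure ⟨_, ?_, rfl⟩
      exact le_trans hc (le_add_of_nonneg_right (hw i).le)
    have h3 := mul_mem h1 h2
    simpa [FormalComm.eval, mul_assoc] using h3
  | one => simp
  | mul x y _ _ hx hy =>
    have := mul_mem hx hy
    simpa [mul_assoc] using this
  | inv x _ hx =>
    have := inv_mem hx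
    simpa [mul_assoc] using this

theorem filtration_normal (hS : Subgroup.closure (Set.range S) = ⊤) (hw : ∀ i, 0 < w i)
    (j : ℕ) : (filtration S w j).Normal := by
  rw [← Subgroup.normalizer_eq_top_iff, eq_top_iff, ← hS, Subgroup.closure_le]
  rintro _ ⟨i, rfl⟩
  have h1 := fun x => filtration_conj_mem (S := S) hw j i 1 (x := x)
  have h2 := fun x => filtration_conj_mem (S := S) hw j i (-1) (x := x)
  simp only [Units.val_one, zpow_one, Units.val_neg, zpow_neg, inv_inv] at h1 h2
  rw [SetLike.mem_coe, Subgroup.mem_normalizer_iff]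
  intro x
  refine ⟨h2 x, fun hx => ?_⟩
  have := h1 _ hx
  simpa [mul_assoc] using this

theorem filtration_comm_mem (hS : Subgroup.closure (Set.range S) = ⊤) (hw : ∀ i, 0 < w i)
    (j : ℕ) {x y : G} (hx : x ∈ filtration S w j) (hy : y ∈ filtration S w j) :
    (x * y)⁻¹ * (y * x) ∈ filtration S w (j + 1) := by
  have hN := filtration_normal hS hw (j + 1)
  rw [← QuotientGroup.eq, QuotientGroup.mk_mul, QuotientGroup.mk_mul]
  let q := QuotientGroup.mk' (filtration S w (j + 1))
  have key : ∀ c₁ c₂ : FormalComm k, wbar w j ≤ c₁.weight w → wbar w j ≤ c₂.weight w →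
      q (c₁.eval S) * q (c₂.eval S) = q (c₂.eval S) * q (c₁.eval S) := by
    intro c₁ c₂ h₁ h₂
    rw [← map_mul, ← map_mul, eq_comm]
    refine QuotientGroup.eq.mpr (Subgroup.subset_closure ⟨.bracket c₁ c₂, ?_, ?_⟩)
    · have hlt : wbar w j < (FormalComm.bracket c₁ c₂).weight w :=
        lt_of_le_of_lt h₁ (lt_add_of_pos_right _ (weight_pos hw c₂))
      change leastOf _ ≤ _
      unfold leastOf
      split_ifs with h
      · exact h.choose_spec.2 ⟨⟨_, rfl⟩, hlt⟩
      · exact (weight_pos hw _).le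
    · simp [FormalComm.eval, mul_assoc]
  change q x * q y = q y * q x
  induction hx using Subgroup.closure_induction with
  | mem x hx =>
    obtain ⟨c₁, h₁, rfl⟩ := hx
    induction hy using Subgroup.closure_induction with
    | mem y hy => obtain ⟨c₂, h₂, rfl⟩ := hy; exact key c₁ c₂ h₁ h₂
    | one => simp
    | mul y z _ _ hy hz => rw [map_mul]; exact (Commute.mul_right hy hz : Commute _ _)
    | inv y _ hy => rw [map_inv]; exact (Commute.inv_right hy : Commute _ _)
  | one => simp
  | mul y z _ _ hy hz => rw [map_mul]; exact (Commute.mul_left hy hz : Commute _ _)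
  | inv y _ hy => rw [map_inv]; exact (Commute.inv_left hy : Commute _ _)

end Filtration

/-! ### Torsion-free ranks and the exponents -/

section Exponents

variable {G : Type*} [Group G] {Γ : Type*} [LinearOrder Γ] [AddCommGroup Γ]
  [IsOrderedAddMonoid Γ] {k : ℕ} {S : Fin k → G} {w : Fin k → Γ}

/-- The successive quotient of the filtration: its `j`-th term modulo its `(j+1)`-st term. -/
abbrev Graded {G : Type*} [Group G] {Γ : Type*} [LinearOrder Γ] [AddCommGroup Γ] {k : ℕ}
    (S : Fin k → G) (w : Fin k → Γ) (j : ℕ) : Type _ :=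
  ↥(filtration S w j) ⧸ (filtration S w (j + 1)).subgroupOf (filtration S w j)

/-- The successive quotients are abelian groups under the quotient multiplication. -/
abbrev gradedCommGroup (hS : Subgroup.closure (Set.range S) = ⊤) (hw : ∀ i, 0 < w i)
    (j : ℕ) : CommGroup (Graded S w j) :=
  haveI := filtration_normal hS hw (j + 1)
  { (inferInstance : Group (Graded S w j)) with
    mul_comm := by
      intro a b
      induction a using QuotientGroup.induction_on with
      | H x =>
        induction b using QuotientGroup.induction_on with
        | H y =>
          exact QuotientGroup.eq.mpr (filtration_comm_mem hS hw j x.2 y.2) }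

/-- The torsion-free rank of the `j`-th successive quotient, i.e. the maximal number of
`ℤ`-linearly independent elements. -/
def gradedRank (hS : Subgroup.closure (Set.range S) = ⊤) (hw : ∀ i, 0 < w i) (j : ℕ) : ℕ :=
  letI := gradedCommGroup hS hw j
  Module.finrank ℤ (Additive (Graded S w j))

/-- The number `j_*` of nontrivial terms of the filtration: the least `j` for which the term of
(zero-based) index `j` is trivial. -/
def jStar {G : Type*} [Group G] {Γ : Type*} [LinearOrder Γ] [AddCommGroup Γ] {k : ℕ}
    (S : Fin k → G) (w : Fin k → Γ) : ℕ :=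
  sInf {j | filtration S w j = ⊥}

/-- `∑_h φ(w̄_h) rank(G^w_h / G^w_{h+1})`, where `φ` is a coordinate of the weight. -/
def exponent (hS : Subgroup.closure (Set.range S) = ⊤) (hw : ∀ i, 0 < w i) (φ : Γ → ℝ) : ℝ :=
  ∑ h ∈ Finset.range (jStar S w), φ (wbar w h) * (gradedRank hS hw h : ℝ)

end Exponents

/-! ### The weight systems attached to a tuple of exponents in `(0, ∞]` -/

/-- `α̃ = min {2, α}`. -/
def tildeAlpha (α : ℝ≥0∞) : ℝ := (min 2 α).toReal

theorem tildeAlpha_pos {α : ℝ≥0∞} (h : 0 < α) : 0 < tildeAlpha α :=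
  ENNReal.toReal_pos (lt_min (by norm_num) h).ne'
    (ne_top_of_le_ne_top (by norm_num) (min_le_left 2 α))

/-- The one-dimensional weights `1 / α̃_i`. -/
def powerWeight {k : ℕ} (a : Fin k → ℝ≥0∞) (i : Fin k) : ℝ := 1 / tildeAlpha (a i)

open Classical in
/-- The two-dimensional weights `(1 / α̃_i, 1/2)` if `α_i = 2` and `(1 / α̃_i, 0)` otherwise, in
`ℝ × ℝ` with the lexicographic order. -/
def logWeight {k : ℕ} (a : Fin k → ℝ≥0∞) (i : Fin k) : ℝ ×ₗ ℝ :=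
  toLex (1 / tildeAlpha (a i), if a i = 2 then 1 / 2 else 0)

theorem powerWeight_pos {k : ℕ} {a : Fin k → ℝ≥0∞} (ha : ∀ i, 0 < a i) (i : Fin k) :
    0 < powerWeight a i :=
  one_div_pos.mpr (tildeAlpha_pos (ha i))

theorem logWeight_pos {k : ℕ} {a : Fin k → ℝ≥0∞} (ha : ∀ i, 0 < a i) (i : Fin k) :
    0 < logWeight a i :=
  Prod.Lex.lt_iff.mpr (Or.inl (one_div_pos.mpr (tildeAlpha_pos (ha i))))

section

variable {G : Type*} [Group G] {k : ℕ} {S : Fin k → G} {a : Fin k → ℝ≥0∞}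

/-- The exponent `D` of the one-dimensional weight system. -/
def exponentD (hS : Subgroup.closure (Set.range S) = ⊤) (ha : ∀ i, 0 < a i) : ℝ :=
  exponent hS (powerWeight_pos ha) (fun v => v)

/-- The exponent `D₁` of the two-dimensional weight system. -/
def exponentD₁ (hS : Subgroup.closure (Set.range S) = ⊤) (ha : ∀ i, 0 < a i) : ℝ :=
  exponent hS (logWeight_pos ha) (fun v => (ofLex v).1)

/-- The exponent `D₂` of the two-dimensional weight system. -/
def exponentD₂ (hS : Subgroup.closure (Set.range S) = ⊤) (ha : ∀ i, 0 < a i) : ℝ :=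
  exponent hS (logWeight_pos ha) (fun v => (ofLex v).2)

end

/-! ### The random walk -/

open Classical in
/-- `(1 + |m|)^{-α-1}`, understood as the indicator function of `{-1, 0, 1}` when `α = ∞`. -/
def stepWeight (α : ℝ≥0∞) (m : ℤ) : ℝ :=
  if α = ⊤ then (if |m| ≤ 1 then 1 else 0)
  else (1 + |(m : ℝ)|) ^ (-α.toReal - 1)

/-- The normalizing constant `c(α)`. -/
def stepConst (α : ℝ≥0∞) : ℝ := (∑' m : ℤ, stepWeight α m)⁻¹

open Classical in
/-- The probability density `μ_{S,a}` on `G`. -/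
def stepMeasure {G : Type*} [Group G] {k : ℕ} (S : Fin k → G) (a : Fin k → ℝ≥0∞) (g : G) : ℝ :=
  (1 / (k : ℝ)) * ∑ i : Fin k, stepConst (a i) *
    ∑' m : ℤ, stepWeight (a i) m * (if S i ^ m = g then 1 else 0)

open Classical in
/-- The `n`-fold convolution power `μ^{(n)}` of a density on a discrete group, with
`μ^{(0)}` the point mass at the identity. -/
def convPow {G : Type*} [Group G] (μ : G → ℝ) : ℕ → G → ℝ
  | 0 => fun g => if g = 1 then 1 else 0
  | n + 1 => fun g => ∑' y : G, convPow μ n y * μ (y⁻¹ * g)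

end NilpotentWalk

end

/-!
# Return probabilities of walks along powers of generators of a nilpotent group

The upper bound comes from a Nash type inequality whose two ingredients are a lower bound on a
volume and a pseudo-Poincaré inequality.

*Volume.* For a formal commutator `c`, the bracket is bilinear modulo commutators of higher weight
(`mk_commutator_eq_zpow`), because `[c₁, c₂]` is central there. Writing exponents in mixed radix,
it follows that every power `c ^ m`, where `m` is at most the product of sizes `R i` over the
letters `s_i^{±1}` of `c`, agrees modulo higher weight with a word of bounded length in the powers
`s_i ^ l`, `|l| ≤ R i` (`exists_word`). In each graded quotient, choose as many independent
commutators of the corresponding weight as its rank. Products of such words, one factor for each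
quotient, are pairwise distinct, as can be seen by decoding them one quotient at a time
(`exists_card_le`). No normal form and no exact formula for `c ^ m` is needed. Choosing `R i` to be
about `r ^ (1 / α̃_i)`, with an extra `√(log r)` if `α_i = 2`, these words reach at least
`V r = r ^ D₁ * (log (e + r)) ^ D₂` elements.

*Pseudo-Poincaré inequality.* Let `ν g` be the `ℓ²` norm of the difference of `f` and its right
translate by `g`. It is subadditive in `g`, and the Dirichlet form of `f` is the mean of `(ν g)²`
over one step of the walk. Averaging `ν (s_i ^ l) ≤ ν (s_i ^ m) + ν (s_i ^ (l - m))` over `m` yields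
`(ν (s_i ^ l))² ≤ C r * energy f` for `|l| ≤ R i` (`exists_sq_le_mul_energy`). The logarithm for
`α_i = 2` appears since all dyadic scales below `√l` contribute equally (`sq_mul_log_le`). The same
bound, with another constant, then holds for words of bounded length.

Comparing the law `f` of the walk after `n` steps with its average over the `V r` translations
gives `u n ≤ K r (u n - u (n + 1)) + 1 / V r` for `u n = ‖f‖²` and all `r ≥ 1`
(`exists_norm_walk_sq_le`); laziness of the walk lets the dissipation `u n - u (n + 1)` of one step
dominate the energy. Summing over half of the times up to `n`, with `r` a small multiple of `n`,
and iterating yields `u n ≤ C / V n` (`exists_le_div_of_nash`). Finally, the return probability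
after `n` steps is at most `u (n / 2)`.

The one-dimensional weight system is treated by the same ranges `R i`, bounding the extra
logarithm from below by `1`.
-/

/-! ### Linearly independent subfamilies of generating families -/

/-- A generating set of a module over a domain contains as many linearly independent elements as
the torsion-free rank: after localizing at the nonzero scalars it spans a vector space of that
dimension. -/
theorem exists_linearIndependent_fin_finrank_of_span_eq_top {R A : Type*} [CommRing R]
    [IsDomain R] [AddCommGroup A] [Module R A] {s : Set A} (hs : Submodule.span R s = ⊤) :
    ∃ f : Fin (Module.finrank R A) → A, (∀ i, f i ∈ s) ∧ LinearIndependent R f := by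
  rcases Nat.eq_zero_or_pos (Module.finrank R A) with h0 | hpos
  · rw [h0]
    exact ⟨Fin.elim0, fun i => i.elim0, linearIndependent_empty_type⟩
  let K := FractionRing R
  let B := LocalizedModule (nonZeroDivisors R) A
  let φ : A →ₗ[R] B := LocalizedModule.mkLinearMap (nonZeroDivisors R) A
  have hrank : Module.finrank K B = Module.finrank R A :=
    (IsFractionRing.finrank_right_eq R B (S := K)).trans
      (IsLocalizedModule.finrank_eq (nonZeroDivisors R) φ le_rfl)
  have : Module.Finite K B := Module.finite_of_finrank_pos (by omega)
  have hspan : Submodule.span K (φ '' s) = ⊤ :=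
    span_eq_top_of_isLocalizedModule K (nonZeroDivisors R) φ hs
  have hn : Module.finrank K (Submodule.span K (φ '' s)) = Module.finrank R A := by
    rw [hspan, finrank_top, hrank]
  obtain ⟨f, hf, -, hli⟩ := Submodule.exists_fun_fin_finrank_span_eq K (φ '' s)
  choose g hgs hg using hf
  have hli' : LinearIndependent R (φ ∘ g) := by
    rw [show φ ∘ g = f from funext hg]
    exact hli.restrict_scalars' R
  rw [← hn]
  exact ⟨g, hgs, hli'.of_comp φ⟩

/-! ### Weight values -/

namespace NilpotentWalk

section Weights

variable {Γ : Type*} [LinearOrder Γ] [AddCommGroup Γ] [IsOrderedAddMonoid Γ] {k : ℕ}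
  {w : Fin k → Γ}

/-- The weight values lie in the additive monoid generated by finitely many positive elements. -/
theorem isWF_range_weight (hw : ∀ i, 0 < w i) :
    (Set.range (FormalComm.weight w)).IsWF := by
  have h : (AddSubmonoid.closure (Set.range w) : Set Γ).IsPWO :=
    Set.IsPWO.addSubmonoid_closure (by rintro _ ⟨i, rfl⟩; exact (hw i).le)
      (Set.finite_range w).isPWO
  refine h.isWF.mono ?_
  rintro _ ⟨c, rfl⟩
  induction c with
  | letter i ε => exact AddSubmonoid.subset_closure ⟨i, rfl⟩
  | bracket c₁ c₂ h₁ h₂ => exact add_mem h₁ h₂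

theorem isLeast_leastOf {Γ : Type*} [LinearOrder Γ] [Zero Γ] {A : Set Γ}
    (hA : A.IsWF) (hne : A.Nonempty) :
    IsLeast A (leastOf A) := by
  have h : ∃ x, IsLeast A x := ⟨hA.min hne, hA.min_mem hne, fun _ hb => hA.min_le hne hb⟩
  unfold leastOf
  rw [dif_pos h]
  exact h.choose_spec

theorem isLeast_wbar_succ (hw : ∀ i, 0 < w i) {j : ℕ} (h : ∃ c, wbar w j ≤ FormalComm.weight w c) :
    IsLeast {v | v ∈ Set.range (FormalComm.weight w) ∧ wbar w j < v} (wbar w (j + 1)) := by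
  obtain ⟨c, hc⟩ := h
  exact isLeast_leastOf ((isWF_range_weight hw).mono fun v hv => hv.1)
    ⟨_, ⟨.bracket c c, rfl⟩, lt_of_le_of_lt hc (lt_add_of_pos_right _ (weight_pos hw c))⟩

theorem wbar_mem_range (hk : 1 ≤ k) (hw : ∀ i, 0 < w i) (j : ℕ) :
    wbar w j ∈ Set.range (FormalComm.weight w) := by
  induction j with
  | zero => exact (isLeast_leastOf (isWF_range_weight hw) ⟨_, .letter ⟨0, hk⟩ 1, rfl⟩).1
  | succ j ih =>
    obtain ⟨c, hc⟩ := ih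
    exact (isLeast_wbar_succ hw ⟨c, hc.ge⟩).1.1

theorem wbar_lt_succ (hk : 1 ≤ k) (hw : ∀ i, 0 < w i) (j : ℕ) : wbar w j < wbar w (j + 1) := by
  obtain ⟨c, hc⟩ := wbar_mem_range hk hw j
  exact (isLeast_wbar_succ hw ⟨c, hc.ge⟩).1.2

theorem wbar_succ_le (hw : ∀ i, 0 < w i) {j : ℕ} {c : FormalComm k}
    (h : wbar w j < c.weight w) : wbar w (j + 1) ≤ c.weight w :=
  (isLeast_wbar_succ hw ⟨c, h.le⟩).2 ⟨⟨c, rfl⟩, h⟩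

end Weights

/-! ### Subgroups generated by the commutators of large weight -/

/-- The subgroup generated by the images of the formal commutators whose weight lies in `T`. -/
def weightSubgroup {G Γ : Type*} [Group G] [Add Γ] {k : ℕ} (S : Fin k → G) (w : Fin k → Γ)
    (T : Set Γ) : Subgroup G :=
  Subgroup.closure (FormalComm.eval S '' {c | c.weight w ∈ T})

section Generators

variable {G Γ : Type*} [Group G] [Add Γ] {k : ℕ} {S : Fin k → G} {w : Fin k → Γ}

theorem eval_mem_weightSubgroup {T : Set Γ} {c : FormalComm k} (h : c.weight w ∈ T) :
    c.eval S ∈ weightSubgroup S w T :=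
  Subgroup.subset_closure ⟨c, h, rfl⟩

theorem weightSubgroup_eq_top (hS : Subgroup.closure (Set.range S) = ⊤) {T : Set Γ}
    (hT : ∀ i, w i ∈ T) : weightSubgroup S w T = ⊤ := by
  rw [eq_top_iff, ← hS, Subgroup.closure_le]
  rintro _ ⟨i, rfl⟩
  have := eval_mem_weightSubgroup (S := S) (w := w) (T := T) (c := .letter i 1) (hT i)
  simpa [FormalComm.eval] using this

/-- Modulo the commutators of weight in `T''`, the subgroups attached to `T` and `T'` commute as
soon as `T + T' ⊆ T''`. -/
theorem commute_mk_of_add_mem {T T' T'' : Set Γ} (hN : (weightSubgroup S w T'').Normal)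
    (hadd : ∀ v ∈ T, ∀ u ∈ T', v + u ∈ T'') {x y : G} (hx : x ∈ weightSubgroup S w T)
    (hy : y ∈ weightSubgroup S w T') :
    Commute (x : G ⧸ weightSubgroup S w T'') (y : G ⧸ weightSubgroup S w T'') := by
  let q := QuotientGroup.mk' (weightSubgroup S w T'')
  change Commute (q x) (q y)
  induction hx using Subgroup.closure_induction with
  | mem x hx =>
    obtain ⟨c₁, h₁, rfl⟩ := hx
    induction hy using Subgroup.closure_induction with
    | mem y hy =>
      obtain ⟨c₂, h₂, rfl⟩ := hy
      change q _ * q _ = q _ * q _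
      rw [← map_mul, ← map_mul, eq_comm]
      refine QuotientGroup.eq.mpr (Subgroup.subset_closure ⟨.bracket c₁ c₂, hadd _ h₁ _ h₂, ?_⟩)
      simp [FormalComm.eval, mul_assoc]
    | one => simp
    | mul y z _ _ hy hz => rw [map_mul]; exact hy.mul_right hz
    | inv y _ hy => rw [map_inv]; exact hy.inv_right
  | one => simp
  | mul y z _ _ hy hz => rw [map_mul]; exact hy.mul_left hz
  | inv y _ hy => rw [map_inv]; exact hy.inv_left

end Generators

/-- If `z = [A, B]` is central, then `[A ^ p, B ^ q] = z ^ (p q)`. -/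
theorem commutator_zpow_zpow {Q : Type*} [Group Q] {A B : Q}
    (hz : ∀ g : Q, Commute (A⁻¹ * B⁻¹ * A * B) g) (p q : ℤ) :
    (A ^ p)⁻¹ * (B ^ q)⁻¹ * A ^ p * B ^ q = (A⁻¹ * B⁻¹ * A * B) ^ (p * q) := by
  set z := A⁻¹ * B⁻¹ * A * B with hzdef
  have h1 : B⁻¹ * A ^ p * B = A ^ p * z ^ p := by
    have : B⁻¹ * A * B = A * z := by rw [hzdef]; group
    rw [← (hz A).symm.mul_zpow, ← this]
    simpa using (conj_zpow (a := B⁻¹) (b := A) (i := p)).symm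
  have h2 : (A ^ p)⁻¹ * B ^ q * A ^ p = B ^ q * (z ^ (p * q))⁻¹ := by
    have : (A ^ p)⁻¹ * B * A ^ p = B * (z ^ p)⁻¹ := by
      rw [eq_mul_inv_iff_mul_eq, mul_assoc, ← h1]; group
    have hc : Commute B (z ^ p)⁻¹ := ((hz B).symm.zpow_right p).inv_right
    have h3 := conj_zpow (a := (A ^ p)⁻¹) (b := B) (i := q)
    rw [inv_inv] at h3
    rw [← h3, this, hc.mul_zpow, inv_zpow, zpow_mul]
  calc (A ^ p)⁻¹ * (B ^ q)⁻¹ * A ^ p * B ^ q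
      = ((A ^ p)⁻¹ * B ^ q * A ^ p)⁻¹ * B ^ q := by group
    _ = z ^ (p * q) := by rw [h2]; group

/-- If `z = [A, B]` is central, `n` commutes with `B` and `n'`, and `n'` commutes with `A`, then
`[A n, B n'] = z`. -/
theorem commutator_mul_mul {Q : Type*} [Group Q] {A B n n' : Q}
    (hz : ∀ g : Q, Commute (A⁻¹ * B⁻¹ * A * B) g) (hnB : Commute n B) (hnn' : Commute n n')
    (hn'A : Commute n' A) :
    (A * n)⁻¹ * (B * n')⁻¹ * (A * n) * (B * n') = A⁻¹ * B⁻¹ * A * B := by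
  have h1 : (A * n) * (B * n') = A * B * (n' * n) := by
    rw [mul_assoc, ← mul_assoc n, hnB.eq, mul_assoc B, hnn'.eq, ← mul_assoc, ← mul_assoc]
  have h2 : (B * n') * (A * n) = B * A * (n' * n) := by
    rw [mul_assoc, ← mul_assoc n', hn'A.eq]; simp [mul_assoc]
  calc (A * n)⁻¹ * (B * n')⁻¹ * (A * n) * (B * n')
      = ((B * n') * (A * n))⁻¹ * ((A * n) * (B * n')) := by group
    _ = (n' * n)⁻¹ * ((A⁻¹ * B⁻¹ * A * B) * (n' * n)) := by rw [h1, h2]; group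
    _ = A⁻¹ * B⁻¹ * A * B := by rw [(hz (n' * n)).eq]; group

section WeightSubgroup

variable {G : Type*} [Group G] {Γ : Type*} [LinearOrder Γ] [AddCommGroup Γ]
  [IsOrderedAddMonoid Γ] {k : ℕ} {S : Fin k → G} {w : Fin k → Γ}

theorem weightSubgroup_normal (hS : Subgroup.closure (Set.range S) = ⊤) (hw : ∀ i, 0 < w i)
    {T : Set Γ} (hT : IsUpperSet T) : (weightSubgroup S w T).Normal := by
  have key : ∀ (i : Fin k) (ε : ℤˣ) (x : G), x ∈ weightSubgroup S w T →
      (S i ^ (ε : ℤ))⁻¹ * x * S i ^ (ε : ℤ) ∈ weightSubgroup S w T := by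
    intro i ε x hx
    induction hx using Subgroup.closure_induction with
    | mem x hx =>
      obtain ⟨c, hc, rfl⟩ := hx
      -- the conjugate of `x` by `s` is `x * [x, s]`
      have h2 : (FormalComm.bracket c (.letter i ε)).eval S ∈ weightSubgroup S w T :=
        eval_mem_weightSubgroup (hT (le_add_of_nonneg_right (hw i).le) hc)
      simpa [FormalComm.eval, mul_assoc] using mul_mem (eval_mem_weightSubgroup (T := T) hc) h2
    | one => simp
    | mul x y _ _ hx hy => simpa [mul_assoc] using mul_mem hx hy
    | inv x _ hx => simpa [mul_assoc] using inv_mem hx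
  rw [← Subgroup.normalizer_eq_top_iff, eq_top_iff, ← hS, Subgroup.closure_le]
  rintro _ ⟨i, rfl⟩
  have h1 := fun x => key i 1 x
  have h2 := fun x => key i (-1) x
  simp only [Units.val_one, zpow_one, Units.val_neg, zpow_neg, inv_inv] at h1 h2
  rw [SetLike.mem_coe, Subgroup.mem_normalizer_iff]
  exact fun x => ⟨h2 x, fun hx => by simpa [mul_assoc] using h1 _ hx⟩

/-- The bracket is bilinear modulo commutators of higher weight. -/
theorem mk_commutator_eq_zpow (hS : Subgroup.closure (Set.range S) = ⊤) (hw : ∀ i, 0 < w i)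
    (c₁ c₂ : FormalComm k) {p q : ℤ} {x y : G}
    (hx : (c₁.eval S ^ p)⁻¹ * x ∈ weightSubgroup S w (Set.Ioi (c₁.weight w)))
    (hy : (c₂.eval S ^ q)⁻¹ * y ∈ weightSubgroup S w (Set.Ioi (c₂.weight w))) :
    ((FormalComm.bracket c₁ c₂).eval S ^ (p * q))⁻¹ * (x⁻¹ * y⁻¹ * x * y) ∈
      weightSubgroup S w (Set.Ioi ((FormalComm.bracket c₁ c₂).weight w)) := by
  set v := c₁.weight w
  set u := c₂.weight w
  have hN : (weightSubgroup S w (Set.Ioi (v + u))).Normal :=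
    weightSubgroup_normal hS hw (isUpperSet_Ioi _)
  change _ ∈ weightSubgroup S w (Set.Ioi (v + u))
  obtain ⟨n, rfl⟩ : ∃ n, x = c₁.eval S ^ p * n := ⟨(c₁.eval S ^ p)⁻¹ * x, by group⟩
  obtain ⟨n', rfl⟩ : ∃ n', y = c₂.eval S ^ q * n' := ⟨(c₂.eval S ^ q)⁻¹ * y, by group⟩
  rw [inv_mul_cancel_left] at hx hy
  have hA : c₁.eval S ^ p ∈ weightSubgroup S w (Set.Ici v) :=
    zpow_mem (eval_mem_weightSubgroup (T := Set.Ici v) le_rfl) _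
  have hB : c₂.eval S ^ q ∈ weightSubgroup S w (Set.Ici u) :=
    zpow_mem (eval_mem_weightSubgroup (T := Set.Ici u) le_rfl) _
  rw [← QuotientGroup.eq]
  set N := weightSubgroup S w (Set.Ioi (v + u))
  -- positivity of the weights makes the commutator of the two images central
  have hz : ∀ g : G ⧸ N,
      Commute (((c₁.eval S : G) : G ⧸ N)⁻¹ * ((c₂.eval S : G) : G ⧸ N)⁻¹ *
        ((c₁.eval S : G) : G ⧸ N) * ((c₂.eval S : G) : G ⧸ N)) g := by
    intro g
    induction g using QuotientGroup.induction_on with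
    | H g =>
      refine commute_mk_of_add_mem (T := Set.Ici (v + u)) (T' := Set.Ioi 0) hN ?_
        (eval_mem_weightSubgroup (c := .bracket c₁ c₂) (T := Set.Ici (v + u)) le_rfl) ?_
      · exact fun a ha b hb => lt_add_of_le_of_pos ha hb
      · rw [weightSubgroup_eq_top hS (T := Set.Ioi 0) hw]; trivial
  have h1 := commutator_zpow_zpow hz p q
  have h2 := commutator_mul_mul (A := ((c₁.eval S : G) : G ⧸ N) ^ p)
    (B := ((c₂.eval S : G) : G ⧸ N) ^ q)
    (n := (n : G ⧸ N)) (n' := (n' : G ⧸ N)) (fun g => by rw [h1]; exact (hz g).zpow_left _)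
    (commute_mk_of_add_mem (T := Set.Ioi v) (T' := Set.Ici u) hN
      (fun a ha b hb => add_lt_add_of_lt_of_le ha hb) hx hB)
    (commute_mk_of_add_mem (T := Set.Ioi v) (T' := Set.Ioi u) hN
      (fun a ha b hb => add_lt_add ha hb) hx hy)
    (commute_mk_of_add_mem (T := Set.Ioi u) (T' := Set.Ici v) hN
      (fun a ha b hb => add_comm a b ▸ add_lt_add_of_le_of_lt hb ha) hy hA)
  rw [h1] at h2
  exact h2.symm

end WeightSubgroup

/-! ### Words in powers of the generators -/

/-- The powers `s_i ^ l` with `|l| ≤ R i`. -/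
def powerSet {G : Type*} [Group G] {k : ℕ} (S : Fin k → G) (R : Fin k → ℕ) : Set G :=
  {g | ∃ (i : Fin k) (l : ℤ), |l| ≤ R i ∧ g = S i ^ l}

/-- The product of the sizes `R i` over the letters of a formal commutator. -/
def FormalComm.size {k : ℕ} (R : Fin k → ℕ) : FormalComm k → ℕ
  | .letter i _ => R i
  | .bracket c₁ c₂ => c₁.size R * c₂.size R

section Words

open scoped Pointwise

variable {G : Type*} [Group G] {k : ℕ} {S : Fin k → G} {R : Fin k → ℕ}

theorem one_mem_powerSet (hk : 1 ≤ k) : 1 ∈ powerSet S R := ⟨⟨0, hk⟩, 0, by simp, by simp⟩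

theorem inv_powerSet : (powerSet S R)⁻¹ = powerSet S R := by
  have h : ∀ g ∈ powerSet S R, g⁻¹ ∈ powerSet S R := by
    rintro _ ⟨i, l, hl, rfl⟩
    exact ⟨i, -l, by simpa using hl, by simp⟩
  ext g
  exact ⟨fun hg => by simpa using h _ hg, fun hg => h _ hg⟩

theorem inv_mem_powerSet_pow {M : ℕ} {g : G} (hg : g ∈ powerSet S R ^ M) :
    g⁻¹ ∈ powerSet S R ^ M := by
  rw [← Set.mem_inv, ← inv_pow, inv_powerSet] at *
  exact hg

theorem commutator_mem_powerSet_pow {M M' : ℕ} {x y : G} (hx : x ∈ powerSet S R ^ M)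
    (hy : y ∈ powerSet S R ^ M') : x⁻¹ * y⁻¹ * x * y ∈ powerSet S R ^ (2 * M + 2 * M') := by
  rw [show 2 * M + 2 * M' = M + M' + M + M' by ring, pow_add, pow_add, pow_add]
  exact Set.mul_mem_mul (Set.mul_mem_mul (Set.mul_mem_mul (inv_mem_powerSet_pow hx)
    (inv_mem_powerSet_pow hy)) hx) hy

variable {Γ : Type*} [LinearOrder Γ] [AddCommGroup Γ] [IsOrderedAddMonoid Γ] {w : Fin k → Γ}

/-- Up to commutators of higher weight, the powers of a formal commutator `c` with exponent at
most `c.size R` are words of bounded length in the elements of `powerSet S R`. For a bracket of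
`c₁` and `c₂`, write the exponent as `a * b + r` with `b = c₂.size R` and combine
`[c₁ ^ a, c₂ ^ b]` with `[c₁, c₂ ^ r]`. -/
theorem exists_word (hS : Subgroup.closure (Set.range S) = ⊤) (hw : ∀ i, 0 < w i) (hk : 1 ≤ k)
    (c : FormalComm k) : ∃ M : ℕ, ∀ (R : Fin k → ℕ) (m : ℕ), m ≤ c.size R →
      ∃ x ∈ powerSet S R ^ M, (c.eval S ^ (m : ℤ))⁻¹ * x ∈
        weightSubgroup S w (Set.Ioi (c.weight w)) := by
  induction c with
  | letter i ε =>
    refine ⟨1, fun R m hm => ⟨_, ?_, by rw [inv_mul_cancel]; exact one_mem _⟩⟩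
    rw [pow_one]
    refine ⟨i, ε * m, ?_, by rw [zpow_mul]; rfl⟩
    rw [abs_mul, Int.isUnit_iff_abs_eq.mp ε.isUnit, one_mul, Nat.abs_cast]
    exact_mod_cast hm
  | bracket c₁ c₂ ih₁ ih₂ =>
    obtain ⟨M₁, h₁⟩ := ih₁
    obtain ⟨M₂, h₂⟩ := ih₂
    refine ⟨(2 * M₁ + 2 * M₂) + (2 * M₁ + 2 * M₂), fun R m hm => ?_⟩
    change m ≤ c₁.size R * c₂.size R at hm
    rcases Nat.eq_zero_or_pos m with rfl | hm0
    · refine ⟨1, Set.one_mem_pow (one_mem_powerSet hk), by simp⟩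
    obtain ⟨hA, hB⟩ : 0 < c₁.size R ∧ 0 < c₂.size R := by
      constructor <;> rw [Nat.pos_iff_ne_zero] <;> intro h <;> simp [h] at hm <;> omega
    obtain ⟨x₁, hx₁, hx₁'⟩ := h₁ R (m / c₂.size R) (Nat.div_le_of_le_mul (by rwa [mul_comm]))
    obtain ⟨y₁, hy₁, hy₁'⟩ := h₂ R (c₂.size R) le_rfl
    obtain ⟨x₂, hx₂, hx₂'⟩ := h₁ R 1 hA
    obtain ⟨y₂, hy₂, hy₂'⟩ := h₂ R (m % c₂.size R) (Nat.mod_lt _ hB).le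
    refine ⟨_, (pow_add (powerSet S R) (2 * M₁ + 2 * M₂) (2 * M₁ + 2 * M₂)).symm ▸
      Set.mul_mem_mul (commutator_mem_powerSet_pow hx₁ hy₁)
        (commutator_mem_powerSet_pow hx₂ hy₂), ?_⟩
    have e₁ := mk_commutator_eq_zpow hS hw c₁ c₂ hx₁' hy₁'
    have e₂ := mk_commutator_eq_zpow hS hw c₁ c₂ hx₂' hy₂'
    have hN := weightSubgroup_normal hS hw
      (isUpperSet_Ioi ((FormalComm.bracket c₁ c₂).weight w))
    rw [← QuotientGroup.eq] at e₁ e₂ ⊢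
    rw [QuotientGroup.mk_mul, ← e₁, ← e₂, ← QuotientGroup.mk_mul, ← zpow_add]
    congr 2
    rw [Nat.cast_one, one_mul]
    exact_mod_cast (Nat.div_add_mod' m (c₂.size R)).symm

end Words

/-! ### Volume lower bound -/

section Counting

open scoped Pointwise

variable {G : Type*} [Group G] {k : ℕ} {S : Fin k → G}
  {Γ : Type*} [LinearOrder Γ] [AddCommGroup Γ] [IsOrderedAddMonoid Γ] {w : Fin k → Γ}

theorem weightSubgroup_Ioi_le_filtration (hw : ∀ i, 0 < w i) (h : ℕ) :
    weightSubgroup S w (Set.Ioi (wbar w h)) ≤ filtration S w (h + 1) :=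
  Subgroup.closure_mono (Set.image_mono fun _ hc => wbar_succ_le hw hc)

theorem filtration_succ_le (hk : 1 ≤ k) (hw : ∀ i, 0 < w i) (h : ℕ) :
    filtration S w (h + 1) ≤ filtration S w h :=
  Subgroup.closure_mono (Set.image_mono fun _ hc => (wbar_lt_succ hk hw h).le.trans hc)

/-- The `h`-th graded quotient contains the images of `gradedRank` many linearly independent
formal commutators of weight exactly `wbar w h`; linear independence is phrased in terms of
representatives in `G`. -/
theorem exists_independent_formalComm (hS : Subgroup.closure (Set.range S) = ⊤)
    (hw : ∀ i, 0 < w i) (hk : 1 ≤ k) (h : ℕ) :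
    ∃ c : Fin (gradedRank hS hw h) → FormalComm k, (∀ j, (c j).weight w = wbar w h) ∧
      ∀ (m m' : Fin (gradedRank hS hw h) → ℤ) (x x' : Fin (gradedRank hS hw h) → G),
        (∀ j, ((c j).eval S ^ m j)⁻¹ * x j ∈ filtration S w (h + 1)) →
        (∀ j, ((c j).eval S ^ m' j)⁻¹ * x' j ∈ filtration S w (h + 1)) →
        (List.ofFn x).prod⁻¹ * (List.ofFn x').prod ∈ filtration S w (h + 1) → m = m' := by
  let _ := gradedCommGroup hS hw h
  let q : filtration S w h →* Graded S w h := MonoidHom.mk' QuotientGroup.mk fun _ _ => rfl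
  have hq : ∀ x y : filtration S w h, q x = q y ↔ (x : G)⁻¹ * y ∈ filtration S w (h + 1) :=
    fun x y => QuotientGroup.eq.trans Subgroup.mem_subgroupOf
  have hq1 : ∀ x : filtration S w h, (x : G) ∈ filtration S w (h + 1) → q x = 1 := by
    intro x hx
    rw [← map_one q, eq_comm, hq]
    simpa using hx
  let s : Set (Additive (Graded S w h)) := {a | ∃ (c : FormalComm k) (hc : c.weight w = wbar w h),
    a = Additive.ofMul (q ⟨c.eval S, Subgroup.subset_closure ⟨c, hc.ge, rfl⟩⟩)}
  have hspan : Submodule.span ℤ s = ⊤ := by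
    rw [eq_top_iff]
    rintro a -
    obtain ⟨⟨x, hx⟩, hxa⟩ : ∃ x, Additive.ofMul (q x) = a := QuotientGroup.mk_surjective a.toMul
    subst hxa
    induction hx using Subgroup.closure_induction with
    | mem x hx =>
      obtain ⟨c, hc, rfl⟩ := hx
      rcases (show wbar w h ≤ c.weight w from hc).eq_or_lt with hc' | hc'
      · exact Submodule.subset_span ⟨c, hc'.symm, rfl⟩
      · rw [hq1 _ (weightSubgroup_Ioi_le_filtration hw h (eval_mem_weightSubgroup hc'))]
        exact zero_mem _
    | one => exact zero_mem _
    | mul x y hx hy hx' hy' =>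
      have := add_mem hx' hy'
      rwa [← ofMul_mul, ← map_mul] at this
    | inv x hx hx' =>
      have := neg_mem hx'
      rwa [← ofMul_inv, ← map_inv] at this
  obtain ⟨f, hf, hli⟩ := exists_linearIndependent_fin_finrank_of_span_eq_top hspan
  choose c hc hfc using hf
  refine ⟨c, hc, fun m m' x x' hx hx' hxx' => ?_⟩
  have key : ∀ (m : Fin (gradedRank hS hw h) → ℤ) (x : Fin (gradedRank hS hw h) → G),
      (∀ j, ((c j).eval S ^ m j)⁻¹ * x j ∈ filtration S w (h + 1)) →
      ∃ y : filtration S w h, (y : G) = (List.ofFn x).prod ∧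
        Additive.ofMul (q y) = ∑ j, m j • f j := by
    intro m x hx
    have hc' : ∀ j, (c j).eval S ∈ filtration S w h := fun j =>
      Subgroup.subset_closure ⟨c j, (hc j).ge, rfl⟩
    have hxm : ∀ j, x j ∈ filtration S w h := by
      intro j
      have := mul_mem (zpow_mem (hc' j) (m j)) (filtration_succ_le hk hw h (hx j))
      rwa [mul_inv_cancel_left] at this
    refine ⟨(List.ofFn fun j => (⟨x j, hxm j⟩ : filtration S w h)).prod, ?_, ?_⟩
    · rw [← Subgroup.coe_subtype, map_list_prod, List.map_ofFn]; rfl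
    · rw [map_list_prod, List.map_ofFn, List.prod_ofFn, ofMul_prod]
      refine Finset.sum_congr rfl fun j _ => ?_
      rw [hfc j, ← ofMul_zpow, ← map_zpow]
      exact congrArg Additive.ofMul ((hq _ _).mpr (hx j)).symm
  obtain ⟨y, hy, hqy⟩ := key m x hx
  obtain ⟨y', hy', hqy'⟩ := key m' x' hx'
  have hsum : ∑ j, m j • f j = ∑ j, m' j • f j := by
    rw [← hqy, ← hqy', (hq y y').mpr (by rw [hy, hy']; exact hxx')]
  exact linearIndependent_iff_injective_fintypeLinearCombination.mp hli hsum

/-- The elements of a bounded power of `powerSet S R` that lie in the `h`-th term of the filtration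
represent many classes modulo the next term. -/
theorem exists_finset_filtration (hS : Subgroup.closure (Set.range S) = ⊤)
    (hw : ∀ i, 0 < w i) (hk : 1 ≤ k) (h : ℕ) :
    ∃ (M : ℕ) (c : Fin (gradedRank hS hw h) → FormalComm k), (∀ j, (c j).weight w = wbar w h) ∧
      ∀ R : Fin k → ℕ, ∃ B : Finset G, (∀ x ∈ B, x ∈ powerSet S R ^ M ∧ x ∈ filtration S w h) ∧
        (∀ x ∈ B, ∀ y ∈ B, x⁻¹ * y ∈ filtration S w (h + 1) → x = y) ∧
        ∏ j, (c j).size R ≤ B.card := by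
  classical
  obtain ⟨c, hc, hinj⟩ := exists_independent_formalComm hS hw hk h
  choose M hM using fun j => exists_word (S := S) hS hw hk (c j)
  refine ⟨(∑ j, M j) * gradedRank hS hw h, c, hc, fun R => ?_⟩
  have hword : ∀ (m : ∀ j, Fin ((c j).size R)) (j : Fin (gradedRank hS hw h)),
      ∃ x ∈ powerSet S R ^ (∑ j, M j),
      ((c j).eval S ^ ((m j : ℕ) : ℤ))⁻¹ * x ∈ filtration S w (h + 1) := by
    intro m j
    obtain ⟨x, hx, hx'⟩ := hM j R (m j) (m j).2.le
    refine ⟨x, Set.pow_subset_pow_right (one_mem_powerSet hk)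
      (Finset.single_le_sum (fun _ _ => Nat.zero_le _) (Finset.mem_univ j)) hx, ?_⟩
    rw [hc j] at hx'
    exact weightSubgroup_Ioi_le_filtration hw h hx'
  choose x hx hx' using hword
  have hinj' : ∀ m m', (List.ofFn (x m)).prod⁻¹ * (List.ofFn (x m')).prod ∈
      filtration S w (h + 1) → m = m' := by
    intro m m' hmm
    have := hinj _ _ _ _ (hx' m) (hx' m') hmm
    funext j
    have hj := congrFun this j
    exact Fin.ext (by exact_mod_cast hj)
  refine ⟨Finset.univ.image fun m => (List.ofFn (x m)).prod, ?_, ?_, ?_⟩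
  · simp only [Finset.mem_image, Finset.mem_univ, true_and]
    rintro _ ⟨m, rfl⟩
    refine ⟨?_, ?_⟩
    · rw [pow_mul, Set.mem_pow]
      exact ⟨fun j => ⟨x m j, hx m j⟩, rfl⟩
    · refine list_prod_mem fun g hg => ?_
      obtain ⟨j, rfl⟩ := List.mem_ofFn.mp hg
      have := mul_mem (zpow_mem (Subgroup.subset_closure ⟨c j, (hc j).ge, rfl⟩ :
        (c j).eval S ∈ filtration S w h) ((m j : ℕ) : ℤ)) (filtration_succ_le hk hw h (hx' m j))
      rwa [mul_inv_cancel_left] at this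
  · simp only [Finset.mem_image, Finset.mem_univ, true_and]
    rintro _ ⟨m, rfl⟩ _ ⟨m', rfl⟩ hmm
    rw [hinj' m m' hmm]
  · rw [Finset.card_image_of_injective _ fun m m' hmm => hinj' m m' (by
      change (List.ofFn (x m)).prod = (List.ofFn (x m')).prod at hmm
      rw [hmm, inv_mul_cancel]; exact one_mem _)]
    simp

/-- Volume lower bound: words of bounded length in the powers `s_i ^ l`, `|l| ≤ R i`, reach at
least as many elements as the product of the sizes of independent formal commutators in all the
graded quotients. An element is decoded one quotient at a time, from the top down. -/
theorem exists_card_le (hS : Subgroup.closure (Set.range S) = ⊤)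
    (hw : ∀ i, 0 < w i) (hk : 1 ≤ k) (J : ℕ) :
    ∃ (M : ℕ) (c : ∀ h, Fin (gradedRank hS hw h) → FormalComm k),
      (∀ h j, (c h j).weight w = wbar w h) ∧
      ∀ R : Fin k → ℕ, ∃ B : Finset G, (∀ x ∈ B, x ∈ powerSet S R ^ M) ∧
        ∏ h ∈ Finset.range J, ∏ j, (c h j).size R ≤ B.card := by
  classical
  choose M c hc hB using exists_finset_filtration (S := S) hS hw hk
  choose B hBM hBinj hBcard using hB
  refine ⟨∑ h ∈ Finset.range J, M h, c, hc, fun R => ?_⟩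
  suffices h : ∃ A : Finset G, (∀ x ∈ A, x ∈ powerSet S R ^ (∑ h ∈ Finset.range J, M h)) ∧
      (∀ x ∈ A, ∀ y ∈ A, x⁻¹ * y ∈ filtration S w J → x = y) ∧
      ∏ h ∈ Finset.range J, ∏ j, (c h j).size R ≤ A.card from
    let ⟨A, h₁, _, h₃⟩ := h
    ⟨A, h₁, h₃⟩
  induction J with
  | zero => exact ⟨{1}, by simp, by simp, by simp⟩
  | succ J ih =>
    obtain ⟨A, hA₁, hA₂, hA₃⟩ := ih
    -- the factors from `B J R` vanish modulo the `J`-th term, so `a` is determined first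
    have hinj : ∀ a ∈ A, ∀ a' ∈ A, ∀ b ∈ B J R, ∀ b' ∈ B J R,
        (a * b)⁻¹ * (a' * b') ∈ filtration S w (J + 1) → a = a' ∧ b = b' := by
      intro a ha a' ha' b hb b' hb' hab
      have haa : a = a' := by
        refine hA₂ a ha a' ha' ?_
        have := mul_mem (mul_mem (hBM J R b hb).2 (filtration_succ_le hk hw J hab))
          (inv_mem (hBM J R b' hb').2)
        simpa [mul_assoc] using this
      subst haa
      exact ⟨rfl, hBinj J R b hb b' hb' (by simpa [mul_assoc] using hab)⟩
    refine ⟨(A ×ˢ B J R).image fun p => p.1 * p.2, ?_, ?_, ?_⟩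
    · simp only [Finset.mem_image, Finset.mem_product]
      rintro _ ⟨⟨a, b⟩, ⟨ha, hb⟩, rfl⟩
      rw [Finset.sum_range_succ, pow_add]
      exact Set.mul_mem_mul (hA₁ a ha) (hBM J R b hb).1
    · simp only [Finset.mem_image, Finset.mem_product]
      rintro _ ⟨⟨a, b⟩, ⟨ha, hb⟩, rfl⟩ _ ⟨⟨a', b'⟩, ⟨ha', hb'⟩, rfl⟩ hab
      obtain ⟨rfl, rfl⟩ := hinj a ha a' ha' b hb b' hb' hab
      rfl
    · rw [Finset.card_image_of_injOn, Finset.card_product, Finset.prod_range_succ]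
      · exact Nat.mul_le_mul hA₃ (hBcard J R)
      · rintro ⟨a, b⟩ hp ⟨a', b'⟩ hp' hab
        obtain ⟨ha, hb⟩ := Finset.mem_product.mp hp
        obtain ⟨ha', hb'⟩ := Finset.mem_product.mp hp'
        simp only at hab
        obtain ⟨rfl, rfl⟩ := hinj a ha a' ha' b hb b' hb' (by
          rw [hab, inv_mul_cancel]; exact one_mem _)
        rfl

end Counting

/-! ### Displacement along one generator -/

theorem stepWeight_nonneg (α : ℝ≥0∞) (m : ℤ) : 0 ≤ stepWeight α m := by
  unfold stepWeight
  split_ifs <;> positivity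

theorem stepWeight_one_pos (α : ℝ≥0∞) : 0 < stepWeight α 1 := by
  unfold stepWeight
  split_ifs with h h'
  · norm_num
  · simp at h'
  · positivity

theorem stepWeight_natCast {α : ℝ≥0∞} (hα : α ≠ ⊤) (l : ℕ) :
    stepWeight α l = ((1 + (l : ℝ)) ^ (α.toReal + 1))⁻¹ := by
  unfold stepWeight
  rw [if_neg hα, ← Real.rpow_neg (by positivity)]
  simp only [Int.cast_natCast, Nat.abs_cast]
  congr 1
  ring

section Displacement

variable {α : ℝ≥0∞} {ν : ℕ → ℝ} {E : ℝ}

theorem le_mul_of_subadditive (h0 : ν 0 = 0) (hadd : ∀ m l, ν (m + l) ≤ ν m + ν l) (q l : ℕ) :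
    ν (q * l) ≤ q * ν l := by
  induction q with
  | zero => simp [h0]
  | succ q ih =>
    have := hadd (q * l) l
    rw [Nat.succ_mul]
    push_cast
    linarith

/-- Averaging `ν M ≤ ν l + ν (M - l)` over `0 ≤ l ≤ M`. -/
theorem sq_le_rpow_mul (hα : α ≠ ⊤) (hnn : ∀ m, 0 ≤ ν m)
    (hadd : ∀ m l, ν (m + l) ≤ ν m + ν l)
    (hE : ∀ N, ∑ l ∈ Finset.range N, stepWeight α l * ν l ^ 2 ≤ E) (M : ℕ) :
    ν M ^ 2 ≤ 4 * (1 + (M : ℝ)) ^ α.toReal * E := by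
  have hM : (0 : ℝ) < 1 + M := by positivity
  have h1 : ∀ l ∈ Finset.range (M + 1), ν M ^ 2 ≤ 2 * ν l ^ 2 + 2 * ν (M - l) ^ 2 := by
    intro l hl
    have hl' : l + (M - l) = M := by have := Finset.mem_range.mp hl; omega
    have h := hadd l (M - l)
    rw [hl'] at h
    nlinarith [hnn M, hnn l, hnn (M - l), sq_nonneg (ν l - ν (M - l))]
  have h2 := Finset.sum_le_sum h1
  have h3 : ∑ l ∈ Finset.range (M + 1), ν (M - l) ^ 2 = ∑ l ∈ Finset.range (M + 1), ν l ^ 2 := by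
    rw [← Finset.sum_range_reflect]
    refine Finset.sum_congr rfl fun l hl => ?_
    have := Finset.mem_range.mp hl
    congr 2
    omega
  rw [Finset.sum_add_distrib, ← Finset.mul_sum, ← Finset.mul_sum, h3, Finset.sum_const,
    Finset.card_range, nsmul_eq_mul] at h2
  have h4 : ∑ l ∈ Finset.range (M + 1), ν l ^ 2 ≤ (1 + (M : ℝ)) ^ (α.toReal + 1) * E := by
    refine le_trans ?_ (mul_le_mul_of_nonneg_left (hE (M + 1)) (by positivity))
    rw [Finset.mul_sum]
    refine Finset.sum_le_sum fun l hl => ?_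
    rw [← mul_assoc]
    refine le_mul_of_one_le_left (sq_nonneg _) ?_
    rw [stepWeight_natCast hα, ← div_eq_mul_inv, one_le_div (by positivity)]
    have : (l : ℝ) ≤ M := by exact_mod_cast Nat.lt_succ_iff.mp (Finset.mem_range.mp hl)
    exact Real.rpow_le_rpow (by positivity) (by linarith)
      (add_nonneg ENNReal.toReal_nonneg zero_le_one)
  rw [Real.rpow_add_one hM.ne'] at h4
  push_cast at h2
  refine le_of_mul_le_mul_left ?_ hM
  nlinarith

theorem sq_le_sq_mul_div (h0 : ν 0 = 0) (hnn : ∀ m, 0 ≤ ν m)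
    (hadd : ∀ m l, ν (m + l) ≤ ν m + ν l)
    (hE : ∀ N, ∑ l ∈ Finset.range N, stepWeight α l * ν l ^ 2 ≤ E) (M : ℕ) :
    ν M ^ 2 ≤ (M : ℝ) ^ 2 * (E / stepWeight α 1) := by
  have h1 : ν 1 ^ 2 ≤ E / stepWeight α 1 := by
    rw [le_div_iff₀ (stepWeight_one_pos α)]
    have := hE 2
    rw [Finset.sum_range_succ, Finset.sum_range_one, h0] at this
    simpa [mul_comm] using this
  have h2 := le_mul_of_subadditive h0 hadd M 1
  rw [mul_one] at h2
  calc ν M ^ 2 ≤ (M * ν 1) ^ 2 := pow_le_pow_left₀ (hnn M) h2 2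
    _ = (M : ℝ) ^ 2 * ν 1 ^ 2 := by ring
    _ ≤ _ := by gcongr

/-- In the critical case `α = 2` every scale `l ≤ √M` contributes the same amount to the energy,
which gains a logarithm: write `M = q l + s` with `s < l`, and sum `ν M ≤ q ν l + s ν 1`. -/
theorem sq_mul_log_le (h0 : ν 0 = 0) (hnn : ∀ m, 0 ≤ ν m)
    (hadd : ∀ m l, ν (m + l) ≤ ν m + ν l)
    (hE : ∀ N, ∑ l ∈ Finset.range N, stepWeight 2 l * ν l ^ 2 ≤ E) {M : ℕ} (hM : 1 ≤ M) :
    ν M ^ 2 * Real.log M ≤ 64 * (M : ℝ) ^ 2 * E := by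
  have hsw : ∀ l : ℕ, stepWeight 2 l = ((1 + (l : ℝ)) ^ 3)⁻¹ := by
    intro l
    rw [stepWeight_natCast (by norm_num)]
    congr 1
    rw [← Real.rpow_natCast]
    norm_num
  have hE0 : 0 ≤ E := by simpa using hE 0
  have hM1 : (1 : ℝ) ≤ M := by exact_mod_cast hM
  have hν1 : ν 1 ^ 2 ≤ 8 * E := by
    have := sq_le_sq_mul_div h0 hnn hadd hE 1
    have h8 : stepWeight 2 1 = 1 / 8 := by
      have := hsw 1
      norm_num at this ⊢
      exact this
    rw [h8] at this
    push_cast at this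
    linarith
  set L := Nat.sqrt M with hL
  have hLM : (L : ℝ) * L ≤ M := by exact_mod_cast Nat.sqrt_le M
  have h1 : ∀ i ∈ Finset.range L, ((i : ℝ) + 1)⁻¹ * ν M ^ 2 ≤
      16 * (M : ℝ) ^ 2 * (stepWeight 2 ((i + 1 : ℕ) : ℤ) * ν (i + 1) ^ 2) + 2 * L * ν 1 ^ 2 := by
    intro i hi
    set l := i + 1 with hl
    have hl1 : (1 : ℝ) ≤ l := by rw [hl]; push_cast; linarith [(Nat.cast_nonneg i : (0 : ℝ) ≤ i)]
    have hlL : (l : ℝ) ≤ L := by exact_mod_cast Finset.mem_range.mp hi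
    have hcast : (i : ℝ) + 1 = l := by rw [hl]; push_cast; ring
    have ha : ν M ≤ (M / l : ℝ) * ν l + l * ν 1 := by
      have e1 := hadd (M / l * l) (M % l)
      rw [Nat.div_add_mod'] at e1
      have e2 := le_mul_of_subadditive h0 hadd (M / l) l
      have e3 := le_mul_of_subadditive h0 hadd (M % l) 1
      rw [mul_one] at e3
      have e4 : ((M / l : ℕ) : ℝ) ≤ M / l := Nat.cast_div_le
      have e5 : ((M % l : ℕ) : ℝ) ≤ l := by exact_mod_cast (Nat.mod_lt M (by omega)).le
      nlinarith [mul_le_mul_of_nonneg_right e4 (hnn l), mul_le_mul_of_nonneg_right e5 (hnn 1)]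
    have hb : ν M ^ 2 ≤ 2 * ((M / l : ℝ) * ν l) ^ 2 + 2 * (l * ν 1) ^ 2 :=
      (pow_le_pow_left₀ (hnn M) ha 2).trans (by
        nlinarith [sq_nonneg ((M / l : ℝ) * ν l - l * ν 1)])
    rw [hcast, hsw]
    have hl0 : (0 : ℝ) < l := by linarith
    have hc : ((l : ℝ) ^ 3)⁻¹ ≤ 8 * ((1 + (l : ℝ)) ^ 3)⁻¹ := by
      rw [← div_eq_mul_inv, inv_eq_one_div, div_le_div_iff₀ (by positivity) (by positivity)]
      have : 1 + (l : ℝ) ≤ 2 * l := by linarith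
      have := pow_le_pow_left₀ (by positivity) this 3
      linarith
    calc (l : ℝ)⁻¹ * ν M ^ 2 ≤ (l : ℝ)⁻¹ * (2 * ((M / l : ℝ) * ν l) ^ 2 + 2 * (l * ν 1) ^ 2) := by
          gcongr
      _ = 2 * (M : ℝ) ^ 2 * ν l ^ 2 * ((l : ℝ) ^ 3)⁻¹ + 2 * l * ν 1 ^ 2 := by
          field_simp
      _ ≤ 2 * (M : ℝ) ^ 2 * ν l ^ 2 * (8 * ((1 + (l : ℝ)) ^ 3)⁻¹) + 2 * L * ν 1 ^ 2 := by
          gcongr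
      _ = _ := by ring
  have h2 := Finset.sum_le_sum h1
  rw [← Finset.sum_mul, Finset.sum_add_distrib, ← Finset.mul_sum, Finset.sum_const,
    Finset.card_range, nsmul_eq_mul] at h2
  have h3 : ∑ i ∈ Finset.range L, stepWeight 2 ((i + 1 : ℕ) : ℤ) * ν (i + 1) ^ 2 ≤ E := by
    have := hE (L + 1)
    rw [Finset.sum_range_succ'] at this
    simpa [h0] using this
  have h4 : Real.log M / 2 ≤ ∑ i ∈ Finset.range L, ((i : ℝ) + 1)⁻¹ := by
    have hh := log_add_one_le_harmonic L
    have hsum : ((harmonic L : ℚ) : ℝ) = ∑ i ∈ Finset.range L, ((i : ℝ) + 1)⁻¹ := by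
      simp [harmonic]
    rw [← hsum]
    refine le_trans ?_ hh
    have hlt : (M : ℝ) ≤ ((L + 1 : ℕ) : ℝ) ^ 2 := by
      exact_mod_cast (Nat.lt_succ_sqrt' M).le
    have := Real.log_le_log (by linarith) hlt
    rw [Real.log_pow] at this
    push_cast at this ⊢
    linarith
  have h5 := mul_le_mul_of_nonneg_right h4 (sq_nonneg (ν M))
  have h6 : (L : ℝ) * (2 * L * ν 1 ^ 2) ≤ 16 * (M : ℝ) ^ 2 * E := by
    have : (M : ℝ) ≤ (M : ℝ) ^ 2 := by nlinarith
    calc (L : ℝ) * (2 * L * ν 1 ^ 2) = 2 * (L * L) * ν 1 ^ 2 := by ring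
      _ ≤ 2 * (M : ℝ) ^ 2 * (8 * E) := by gcongr; linarith
      _ = _ := by ring
  have h7 := mul_le_mul_of_nonneg_left h3 (show (0 : ℝ) ≤ 16 * (M : ℝ) ^ 2 by positivity)
  linarith

end Displacement

open Classical in
/-- The range of powers `s ^ m` that the walk with exponent `α` explores in time `r`: up to
rounding, `r ^ (1 / α̃)`, with an extra factor `√(log r)` when `α = 2`. -/
noncomputable def jumpRange (α : ℝ≥0∞) (r : ℕ) : ℕ :=
  ⌈(r : ℝ) ^ (1 / tildeAlpha α) *
    Real.log (Real.exp 1 + r) ^ (if α = 2 then (1 / 2 : ℝ) else 0)⌉₊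

theorem one_le_log_exp_one_add (r : ℕ) : 1 ≤ Real.log (Real.exp 1 + r) := by
  rw [Real.le_log_iff_exp_le (by positivity)]
  linarith [(Nat.cast_nonneg r : (0 : ℝ) ≤ r)]

open Classical in
theorem le_jumpRange (α : ℝ≥0∞) (r : ℕ) : (r : ℝ) ^ (1 / tildeAlpha α) *
    Real.log (Real.exp 1 + r) ^ (if α = 2 then (1 / 2 : ℝ) else 0) ≤ jumpRange α r :=
  Nat.le_ceil _

/-- A displacement function `ν` of energy `E` satisfies `ν m ^ 2 ≤ C r E` for every
`m ≤ jumpRange α r`. -/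
theorem exists_sq_le_mul_energy {α : ℝ≥0∞} (hα : 0 < α) : ∃ C : ℝ, 0 < C ∧
    ∀ (ν : ℕ → ℝ) (E : ℝ), ν 0 = 0 → (∀ m, 0 ≤ ν m) → (∀ m l, ν (m + l) ≤ ν m + ν l) →
      (∀ N, ∑ l ∈ Finset.range N, stepWeight α l * ν l ^ 2 ≤ E) →
      ∀ r : ℕ, 1 ≤ r → ∀ m ≤ jumpRange α r, ν m ^ 2 ≤ C * r * E := by
  have hceil : ∀ (x : ℝ) (m : ℕ), 1 ≤ x → m ≤ ⌈x⌉₊ → (m : ℝ) ≤ 2 * x := by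
    intro x m hx hm
    have h1 : (m : ℝ) ≤ ⌈x⌉₊ := by exact_mod_cast hm
    have h2 := Nat.ceil_lt_add_one (zero_le_one.trans hx)
    linarith
  have hpow : ∀ (a : ℝ) (r : ℕ), 0 < a → 1 ≤ r → (1 : ℝ) ≤ (r : ℝ) ^ (1 / a) := fun a r ha hr =>
    Real.one_le_rpow (by exact_mod_cast hr) (by positivity)
  rcases lt_trichotomy α 2 with h | rfl | h
  · have htop : α ≠ ⊤ := (h.trans ENNReal.coe_lt_top).ne
    have ht : tildeAlpha α = α.toReal := by rw [tildeAlpha, min_eq_right h.le]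
    have hpos : 0 < α.toReal := ENNReal.toReal_pos hα.ne' htop
    refine ⟨4 * 3 ^ α.toReal, by positivity, fun ν E h0 hnn hadd hE r hr m hm => ?_⟩
    have hE0 : 0 ≤ E := by simpa using hE 0
    refine (sq_le_rpow_mul htop hnn hadd hE m).trans ?_
    simp only [jumpRange, if_neg h.ne, Real.rpow_zero, mul_one, ht] at hm
    have hx := hpow _ r hpos hr
    have h1 := hceil _ m hx hm
    have h2 : (1 + (m : ℝ)) ^ α.toReal ≤ 3 ^ α.toReal * r := by
      calc (1 + (m : ℝ)) ^ α.toReal ≤ (3 * (r : ℝ) ^ (1 / α.toReal)) ^ α.toReal :=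
            Real.rpow_le_rpow (by positivity) (by linarith) hpos.le
        _ = 3 ^ α.toReal * r := by
            rw [Real.mul_rpow (by norm_num) (by positivity), ← Real.rpow_mul (by positivity),
              one_div_mul_cancel hpos.ne', Real.rpow_one]
    calc 4 * (1 + (m : ℝ)) ^ α.toReal * E ≤ 4 * (3 ^ α.toReal * r) * E := by gcongr
      _ = _ := by ring
  · have ht : tildeAlpha 2 = 2 := by simp [tildeAlpha]
    refine ⟨512, by norm_num, fun ν E h0 hnn hadd hE r hr m hm => ?_⟩
    have hE0 : 0 ≤ E := by simpa using hE 0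
    have hr1 : (1 : ℝ) ≤ r := by exact_mod_cast hr
    simp only [jumpRange, if_true, ht] at hm
    set L := Real.log (Real.exp 1 + r) with hL
    have hL1 : 1 ≤ L := one_le_log_exp_one_add r
    have h1 := hceil _ m (one_le_mul_of_one_le_of_one_le (hpow 2 r two_pos hr)
      (Real.one_le_rpow hL1 (by norm_num))) hm
    rw [← Real.sqrt_eq_rpow, ← Real.sqrt_eq_rpow] at h1
    have h2 : (m : ℝ) ^ 2 ≤ 4 * r * L := by
      calc (m : ℝ) ^ 2 ≤ (2 * (√r * √L)) ^ 2 := pow_le_pow_left₀ (by positivity) h1 2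
        _ = 4 * (√r ^ 2) * (√L ^ 2) := by ring
        _ = _ := by rw [Real.sq_sqrt (by positivity), Real.sq_sqrt (by positivity)]
    -- beyond the threshold, `e + r ≤ 9 * r < m ^ 2` turns `log m` into `log (e + r)`
    rcases le_or_gt ((m : ℝ) ^ 2) (9 * r) with h3 | h3
    · have h4 := sq_le_sq_mul_div h0 hnn hadd hE m
      have h8 : stepWeight 2 1 = 1 / 8 := by
        have := stepWeight_natCast (α := 2) (by norm_num) 1
        norm_num at this ⊢
        rw [this]
      rw [h8] at h4
      have := mul_le_mul_of_nonneg_right h3 hE0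
      have : 0 ≤ (r : ℝ) * E := by positivity
      nlinarith
    · have hm1 : 1 ≤ m := by
        rcases Nat.eq_zero_or_pos m with rfl | h
        · norm_num at h3; linarith
        · exact h
      have h4 := sq_mul_log_le h0 hnn hadd hE hm1
      have h5 : L ≤ 2 * Real.log m := by
        have : Real.log (Real.exp 1 + r) ≤ Real.log ((m : ℝ) ^ 2) := by
          refine Real.log_le_log (by positivity) ?_
          linarith [Real.exp_one_lt_d9]
        rw [Real.log_pow] at this
        exact_mod_cast this
      have hL0 : 0 < L := by linarith
      refine le_of_mul_le_mul_right ?_ hL0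
      calc ν m ^ 2 * L ≤ ν m ^ 2 * (2 * Real.log m) := by gcongr
        _ ≤ 2 * (64 * (m : ℝ) ^ 2 * E) := by linarith
        _ ≤ 2 * (64 * (4 * r * L) * E) := by gcongr
        _ = _ := by ring
  · have ht : tildeAlpha α = 2 := by simp [tildeAlpha, min_eq_left h.le]
    have hs := stepWeight_one_pos α
    refine ⟨4 / stepWeight α 1, by positivity, fun ν E h0 hnn hadd hE r hr m hm => ?_⟩
    have hE0 : 0 ≤ E := by simpa using hE 0
    simp only [jumpRange, if_neg h.ne', Real.rpow_zero, mul_one, ht] at hm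
    have h1 := hceil _ m (hpow 2 r two_pos hr) hm
    rw [← Real.sqrt_eq_rpow] at h1
    have h2 : (m : ℝ) ^ 2 ≤ 4 * r := by
      calc (m : ℝ) ^ 2 ≤ (2 * √r) ^ 2 := pow_le_pow_left₀ (by positivity) h1 2
        _ = 4 * (√r ^ 2) := by ring
        _ = _ := by rw [Real.sq_sqrt (by positivity)]
    calc ν m ^ 2 ≤ (m : ℝ) ^ 2 * (E / stepWeight α 1) := sq_le_sq_mul_div h0 hnn hadd hE m
      _ ≤ 4 * r * (E / stepWeight α 1) := by gcongr
      _ = _ := by ring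

/-! ### Averages of right translations on square summable functions -/

section Hilbert

variable {G : Type*} [Group G]

/-- Square summable real functions on `G`. -/
abbrev SqSummable (G : Type*) : Type _ := lp (fun _ : G => ℝ) 2

theorem sqSummable_norm_sq {G : Type*} (f : SqSummable G) : ‖f‖ ^ 2 = ∑' x, f x ^ 2 := by
  have := lp.norm_rpow_eq_tsum (p := 2) (by norm_num) f
  simpa using this

/-- Right translation `(translate g f) x = f (x * g)`, a linear isometry. -/
noncomputable def translate (g : G) : SqSummable G →ₗᵢ[ℝ] SqSummable G where
  toFun f := ⟨fun x => f (x * g), by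
    have hf := (lp.memℓp f).summable (by norm_num)
    exact memℓp_gen ((Equiv.mulRight g).summable_iff.mpr hf)⟩
  map_add' f f' := rfl
  map_smul' c f := rfl
  norm_map' f := by
    rw [← sq_eq_sq₀ (norm_nonneg _) (norm_nonneg _), sqSummable_norm_sq, sqSummable_norm_sq]
    exact (Equiv.mulRight g).tsum_eq fun x => f x ^ 2

theorem translate_apply (g : G) (f : SqSummable G) (x : G) : translate g f x = f (x * g) := rfl

theorem translate_one (f : SqSummable G) : translate 1 f = f := by
  ext x; simp [translate_apply]

theorem translate_mul (g h : G) (f : SqSummable G) :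
    translate (g * h) f = translate g (translate h f) := by
  ext x; simp [translate_apply, mul_assoc]

theorem inner_translate (g : G) (f f' : SqSummable G) :
    inner ℝ (translate g f) f' = inner ℝ f (translate g⁻¹ f') := by
  have := (translate g).inner_map_map f (translate g⁻¹ f')
  rwa [← translate_mul, mul_inv_cancel, translate_one] at this

/-- How far `f` is moved by the right translation by `g`. -/
noncomputable def displacement (f : SqSummable G) (g : G) : ℝ := ‖translate g f - f‖

variable {f : SqSummable G}

theorem displacement_nonneg (g : G) : 0 ≤ displacement f g := norm_nonneg _

theorem displacement_one : displacement f 1 = 0 := by simp [displacement, translate_one]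

theorem displacement_mul_le (g h : G) :
    displacement f (g * h) ≤ displacement f g + displacement f h := by
  have h1 : translate (g * h) f - f = (translate g f - f) + translate g (translate h f - f) := by
    rw [translate_mul, map_sub]; abel
  rw [displacement, h1]
  exact (norm_add_le _ _).trans (by rw [LinearIsometry.norm_map]; rfl)

theorem displacement_inv (g : G) : displacement f g⁻¹ = displacement f g := by
  rw [displacement, ← (translate g).norm_map, map_sub, ← translate_mul, mul_inv_cancel,
    translate_one, norm_sub_rev, displacement]

theorem displacement_sq (g : G) :
    displacement f g ^ 2 = 2 * (‖f‖ ^ 2 - inner ℝ (translate g f) f) := by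
  rw [displacement, norm_sub_sq_real, LinearIsometry.norm_map]; ring

open scoped Pointwise in
theorem displacement_le_of_mem_pow {T : Set G} {b : ℝ} (hT : ∀ g ∈ T, displacement f g ≤ b)
    {M : ℕ} {g : G} (hg : g ∈ T ^ M) : displacement f g ≤ M * b := by
  induction M generalizing g with
  | zero =>
    rw [pow_zero, Set.mem_one] at hg
    simp [hg, displacement_one]
  | succ M ih =>
    rw [pow_succ] at hg
    obtain ⟨x, hx, y, hy, rfl⟩ := hg
    push_cast
    linarith [displacement_mul_le (f := f) x y, ih hx, hT y hy]

/-- A nonnegative function with mass at most `1` which is moved little by many translations has a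
small norm: compare it with its average over these translations. -/
theorem norm_sq_le_of_displacement_le (hf : ∀ x, 0 ≤ f x) (hf1 : ∀ s : Finset G, ∑ x ∈ s, f x ≤ 1)
    {U : Finset G} (hU : U.Nonempty) {b : ℝ} (hb : ∀ g ∈ U, displacement f g ^ 2 ≤ b) :
    ‖f‖ ^ 2 ≤ b / 2 + 1 / U.card := by
  have hsum : Summable fun x => f x := summable_of_sum_le hf hf1
  have hle1 : ∑' x, f x ≤ 1 := hsum.tsum_le_of_sum_le hf1
  have hc : (0 : ℝ) < U.card := by exact_mod_cast hU.card_pos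
  have h1 : inner ℝ (∑ g ∈ U, translate g f) f ≤ 1 := by
    have h2 := lp.hasSum_inner (𝕜 := ℝ) (∑ g ∈ U, translate g f) f
    refine le_trans ?_ hle1
    refine hasSum_le (fun x => ?_) h2 hsum.hasSum
    have h3 : (∑ g ∈ U, translate g f : SqSummable G) x = ∑ g ∈ U, f (x * g) := by
      rw [lp.coeFn_sum, Finset.sum_apply]; rfl
    have h4 : ∑ g ∈ U, f (x * g) ≤ 1 := by
      have := hf1 (U.map (Equiv.mulLeft x).toEmbedding)
      simpa using this
    rw [h3]
    simp only [RCLike.inner_apply, conj_trivial]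
    exact mul_le_of_le_one_right (hf x) h4
  have h2 : ∑ g ∈ U, (‖f‖ ^ 2 - inner ℝ (translate g f) f) ≤ U.card * (b / 2) := by
    rw [← nsmul_eq_mul]
    refine Finset.sum_le_card_nsmul _ _ _ fun g hg => ?_
    have := hb g hg
    rw [displacement_sq] at this
    linarith
  rw [Finset.sum_sub_distrib, ← sum_inner, Finset.sum_const, nsmul_eq_mul] at h2
  refine le_of_mul_le_mul_left ?_ hc
  rw [mul_add, mul_one_div_cancel hc.ne']
  linarith

variable {ι : Type*}

/-- The average `∑ i, p i • f (· * σ i)` of right translates of `f`. -/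
noncomputable def average (p : ι → ℝ) (σ : ι → G) (f : SqSummable G) : SqSummable G :=
  ∑' i, p i • translate (σ i) f

variable {p : ι → ℝ} {σ : ι → G}

theorem hasSum_average (hp : Summable p) (hp0 : ∀ i, 0 ≤ p i) (f : SqSummable G) :
    HasSum (fun i => p i • translate (σ i) f) (average p σ f) := by
  refine Summable.hasSum (Summable.of_norm ?_)
  simp only [norm_smul, LinearIsometry.norm_map, Real.norm_of_nonneg (hp0 _)]
  exact hp.mul_right _

theorem hasSum_average_apply (hp : Summable p) (hp0 : ∀ i, 0 ≤ p i) (f : SqSummable G) (x : G) :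
    HasSum (fun i => p i * f (x * σ i)) (average p σ f x) :=
  (hasSum_average hp hp0 f).mapL (lp.evalCLM ℝ (fun _ : G => ℝ) 2 x)

theorem hasSum_inner_average (hp : Summable p) (hp0 : ∀ i, 0 ≤ p i) (f f' : SqSummable G) :
    HasSum (fun i => p i * inner ℝ (translate (σ i) f) f') (inner ℝ (average p σ f) f') := by
  have := (hasSum_average (σ := σ) hp hp0 f).mapL (innerSL ℝ f')
  simpa [real_inner_comm, inner_smul_right] using this

/-- Averages over symmetric weights are self-adjoint. -/
theorem inner_average_comm (hp : Summable p) (hp0 : ∀ i, 0 ≤ p i) (e : ι ≃ ι)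
    (hpe : ∀ i, p (e i) = p i) (hσe : ∀ i, σ (e i) = (σ i)⁻¹) (f f' : SqSummable G) :
    inner ℝ (average p σ f) f' = inner ℝ f (average p σ f') := by
  refine (hasSum_inner_average hp hp0 f f').unique ?_
  have := e.hasSum_iff.mpr (hasSum_inner_average (σ := σ) hp hp0 f' f)
  rw [real_inner_comm] at this
  refine this.congr_fun fun i => ?_
  rw [Function.comp_apply, hpe, hσe, inner_translate, real_inner_comm]

theorem hasSum_energy (hp : HasSum p 1) (hp0 : ∀ i, 0 ≤ p i) (f : SqSummable G) :
    HasSum (fun i => p i * displacement f (σ i) ^ 2)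
      (2 * (‖f‖ ^ 2 - inner ℝ (average p σ f) f)) := by
  have h := ((hp.mul_right (‖f‖ ^ 2)).sub
    (hasSum_inner_average (σ := σ) hp.summable hp0 f f)).mul_left 2
  rw [one_mul] at h
  refine h.congr_fun fun i => ?_
  rw [displacement_sq]; ring

theorem norm_average_le (hp : HasSum p 1) (hp0 : ∀ i, 0 ≤ p i) (f : SqSummable G) :
    ‖average p σ f‖ ≤ ‖f‖ := by
  refine (tsum_of_norm_bounded (hp.mul_right ‖f‖) fun i => ?_).trans_eq (one_mul _)
  rw [norm_smul, LinearIsometry.norm_map, Real.norm_of_nonneg (hp0 _)]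

/-- Laziness: as the average contains `f` itself with a weight `p i₀`, one step of the walk
dissipates a definite proportion of the energy. -/
theorem energy_le_norm_sq_sub (hp : HasSum p 1) (hp0 : ∀ i, 0 ≤ p i) {i₀ : ι} (hi₀ : σ i₀ = 1)
    (f : SqSummable G) :
    p i₀ * (2 * (‖f‖ ^ 2 - inner ℝ (average p σ f) f)) ≤ ‖f‖ ^ 2 - ‖average p σ f‖ ^ 2 := by
  classical
  -- the remaining terms have total weight `1 - p i₀`
  have h1 : ‖average p σ f - p i₀ • f‖ ≤ (1 - p i₀) * ‖f‖ := by
    have h2 := (hasSum_average (σ := σ) hp.summable hp0 f).update i₀ 0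
    have h3 := (hp.mul_right ‖f‖).update i₀ 0
    rw [hi₀, translate_one, zero_sub, neg_add_eq_sub] at h2
    rw [zero_sub, neg_add_eq_sub, ← sub_mul] at h3
    rw [← h2.tsum_eq]
    refine tsum_of_norm_bounded h3 fun i => ?_
    by_cases hi : i = i₀
    · subst hi; simp
    · simp [hi, norm_smul, abs_of_nonneg (hp0 i)]
  have hp1 : p i₀ ≤ 1 := le_hasSum hp i₀ fun j _ => hp0 j
  have h2 := pow_le_pow_left₀ (norm_nonneg _) h1 2
  rw [norm_sub_sq_real, inner_smul_right, norm_smul, Real.norm_of_nonneg (hp0 i₀)] at h2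
  nlinarith

/-- The mass bound is inherited by averages. -/
theorem average_sum_le (hp : HasSum p 1) (hp0 : ∀ i, 0 ≤ p i)
    (hf1 : ∀ s : Finset G, ∑ x ∈ s, f x ≤ 1) (s : Finset G) :
    ∑ x ∈ s, average p σ f x ≤ 1 := by
  refine hasSum_le (fun i => ?_)
    (hasSum_sum fun x _ => hasSum_average_apply (σ := σ) hp.summable hp0 f x) hp
  rw [← Finset.mul_sum]
  refine mul_le_of_le_one_right (hp0 i) ?_
  have := hf1 (s.map (Equiv.mulRight (σ i)).toEmbedding)
  simpa using this

theorem average_nonneg (hp0 : ∀ i, 0 ≤ p i) (hp : Summable p) (hf : ∀ x, 0 ≤ f x) (x : G) :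
    0 ≤ average p σ f x :=
  (hasSum_average_apply hp hp0 f x).nonneg fun i => mul_nonneg (hp0 i) (hf _)

open Classical in
/-- The distribution after `n` steps. -/
noncomputable def walk (p : ι → ℝ) (σ : ι → G) : ℕ → SqSummable G
  | 0 => lp.single 2 1 1
  | n + 1 => average p σ (walk p σ n)

theorem walk_nonneg (hp0 : ∀ i, 0 ≤ p i) (hp : Summable p) (n : ℕ) (x : G) :
    0 ≤ walk p σ n x := by
  classical
  induction n generalizing x with
  | zero =>
    simp only [walk, lp.single_apply, Pi.single_apply]
    split_ifs <;> norm_num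
  | succ n ih => exact average_nonneg hp0 hp ih x

theorem walk_sum_le (hp : HasSum p 1) (hp0 : ∀ i, 0 ≤ p i) (n : ℕ) (s : Finset G) :
    ∑ x ∈ s, walk p σ n x ≤ 1 := by
  classical
  induction n generalizing s with
  | zero =>
    simp only [walk, lp.single_apply, Pi.single_apply, Finset.sum_ite_eq']
    split_ifs <;> norm_num
  | succ n ih => exact average_sum_le hp hp0 ih s

theorem inner_walk (hp : Summable p) (hp0 : ∀ i, 0 ≤ p i) (e : ι ≃ ι)
    (hpe : ∀ i, p (e i) = p i) (hσe : ∀ i, σ (e i) = (σ i)⁻¹) (n m : ℕ) :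
    inner ℝ (walk p σ n) (walk p σ m) = walk p σ (n + m) 1 := by
  classical
  induction n generalizing m with
  | zero =>
    rw [zero_add, walk, lp.inner_single_left]
    simp
  | succ n ih =>
    rw [walk, inner_average_comm hp hp0 e hpe hσe, show n + 1 + m = n + (m + 1) by ring]
    exact ih (m + 1)

theorem norm_walk_antitone (hp : HasSum p 1) (hp0 : ∀ i, 0 ≤ p i) :
    Antitone fun n => ‖walk p σ n‖ :=
  antitone_nat_of_succ_le fun _ => norm_average_le hp hp0 _

theorem walk_one_le_norm_sq (hp : HasSum p 1) (hp0 : ∀ i, 0 ≤ p i) (e : ι ≃ ι)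
    (hpe : ∀ i, p (e i) = p i) (hσe : ∀ i, σ (e i) = (σ i)⁻¹) (n : ℕ) :
    walk p σ n 1 ≤ ‖walk p σ (n / 2)‖ ^ 2 := by
  have h := inner_walk hp.summable hp0 e hpe hσe (n / 2) (n - n / 2)
  rw [show n / 2 + (n - n / 2) = n by omega] at h
  rw [← h, sq]
  exact (real_inner_le_norm _ _).trans (mul_le_mul_of_nonneg_left
    (norm_walk_antitone hp hp0 (by omega)) (norm_nonneg _))

end Hilbert

/-! ### Identification of the convolution powers -/

theorem stepWeight_neg (α : ℝ≥0∞) (m : ℤ) : stepWeight α (-m) = stepWeight α m := by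
  simp [stepWeight]

theorem summable_stepWeight {α : ℝ≥0∞} (hα : 0 < α) : Summable (stepWeight α) := by
  by_cases h : α = ⊤
  · refine summable_of_hasFiniteSupport ((Set.finite_Icc (-1 : ℤ) 1).subset fun m hm => ?_)
    rw [Function.mem_support, stepWeight, if_pos h] at hm
    by_contra hm'
    exact hm (if_neg fun h' => hm' (abs_le.mp h'))
  · have hs : Summable fun l : ℕ => stepWeight α l := by
      have h1 := (summable_nat_add_iff 1).mpr (Real.summable_nat_rpow_inv.mpr
        (lt_add_of_pos_left 1 (ENNReal.toReal_pos hα.ne' h)))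
      refine h1.congr fun l => ?_
      rw [stepWeight_natCast h]
      push_cast
      rw [add_comm (l : ℝ) 1]
    exact Summable.of_nat_of_neg hs (by simpa [stepWeight_neg] using hs)

theorem stepConst_pos {α : ℝ≥0∞} (hα : 0 < α) : 0 < stepConst α :=
  inv_pos.mpr ((summable_stepWeight hα).tsum_pos (stepWeight_nonneg α) 1 (stepWeight_one_pos α))

section Walk

variable {G : Type*} [Group G] {k : ℕ}

/-- The probability that the walk multiplies by the power `s_i ^ m`. -/
noncomputable def jumpProb (a : Fin k → ℝ≥0∞) (q : Fin k × ℤ) : ℝ :=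
  1 / (k : ℝ) * (stepConst (a q.1) * stepWeight (a q.1) q.2)

/-- The group element by which the walk multiplies. -/
def jump (S : Fin k → G) (q : Fin k × ℤ) : G := S q.1 ^ q.2

variable {S : Fin k → G} {a : Fin k → ℝ≥0∞}

theorem jumpProb_nonneg (ha : ∀ i, 0 < a i) (q : Fin k × ℤ) : 0 ≤ jumpProb a q :=
  mul_nonneg (by positivity) (mul_nonneg (stepConst_pos (ha _)).le (stepWeight_nonneg _ _))

theorem hasSum_jumpProb (hk : 1 ≤ k) (ha : ∀ i, 0 < a i) : HasSum (jumpProb a) 1 := by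
  have h1 : ∀ i, HasSum (fun m => jumpProb a (i, m)) (1 / (k : ℝ)) := by
    intro i
    have := ((summable_stepWeight (ha i)).hasSum.mul_left (stepConst (a i))).mul_left (1 / (k : ℝ))
    have h2 : stepConst (a i) * ∑' m, stepWeight (a i) m = 1 :=
      inv_mul_cancel₀ (inv_pos.mp (stepConst_pos (ha i))).ne'
    rwa [h2, mul_one] at this
  have hs : Summable (jumpProb a) :=
    (summable_prod_of_nonneg (jumpProb_nonneg ha)).mpr ⟨fun i => (h1 i).summable, .of_finite⟩
  have h3 : ∑' q, jumpProb a q = 1 := by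
    rw [hs.tsum_prod, tsum_fintype, Finset.sum_congr rfl fun i _ => (h1 i).tsum_eq]
    have : (k : ℝ) ≠ 0 := by positivity
    simp [this]
  exact h3 ▸ hs.hasSum

/-- The symmetry `m ↦ -m` of the jumps. -/
def jumpNeg (k : ℕ) : Fin k × ℤ ≃ Fin k × ℤ := (Equiv.refl _).prodCongr (Equiv.neg ℤ)

theorem jumpProb_neg (q : Fin k × ℤ) : jumpProb a (jumpNeg k q) = jumpProb a q := by
  simp [jumpProb, jumpNeg, stepWeight_neg]

theorem jump_neg (q : Fin k × ℤ) : jump S (jumpNeg k q) = (jump S q)⁻¹ := by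
  simp [jump, jumpNeg]

open Classical in
theorem stepMeasure_eq_tsum (hk : 1 ≤ k) (ha : ∀ i, 0 < a i) (g : G) :
    stepMeasure S a g = ∑' q, jumpProb a q * (if jump S q = g then 1 else 0) := by
  have hs : Summable fun q => jumpProb a q * (if jump S q = g then (1 : ℝ) else 0) := by
    refine Summable.of_nonneg_of_le (fun q => ?_) (fun q => ?_) (hasSum_jumpProb hk ha).summable
    · exact mul_nonneg (jumpProb_nonneg ha q) (by split_ifs <;> norm_num)
    · exact mul_le_of_le_one_right (jumpProb_nonneg ha q) (by split_ifs <;> norm_num)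
  rw [hs.tsum_prod, tsum_fintype, stepMeasure, Finset.mul_sum]
  refine Finset.sum_congr rfl fun i _ => ?_
  rw [← tsum_mul_left, ← tsum_mul_left]
  refine tsum_congr fun m => ?_
  by_cases h : S i ^ m = g <;> simp [jumpProb, jump, h]

theorem convPow_eq_walk (hk : 1 ≤ k) (ha : ∀ i, 0 < a i) (n : ℕ) (g : G) :
    convPow (stepMeasure S a) n g = walk (jumpProb a) (jump S) n g := by
  classical
  induction n generalizing g with
  | zero =>
    simp only [convPow, walk, lp.single_apply, Pi.single_apply]
  | succ n ih =>
    have hp := hasSum_jumpProb hk ha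
    have hp0 := jumpProb_nonneg ha
    set f := walk (jumpProb a) (jump S) n with hf
    have hf0 : ∀ x, 0 ≤ f x := walk_nonneg hp0 hp.summable n
    have havg := hasSum_average_apply (σ := jump S) hp.summable hp0 f g
    rw [← (jumpNeg k).hasSum_iff] at havg
    let F : Fin k × ℤ → G → ℝ := fun q y =>
      f y * (jumpProb a q * if jump S q = y⁻¹ * g then 1 else 0)
    have hF : ∀ q, HasSum (F q) (jumpProb a q * f (g * (jump S q)⁻¹)) := by
      intro q
      have h1 := hasSum_single (f := F q) (g * (jump S q)⁻¹) fun y hy => by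
        have : jump S q ≠ y⁻¹ * g := by
          rintro h
          exact hy (by rw [h]; group)
        simp [F, this]
      have h2 : F q (g * (jump S q)⁻¹) = jumpProb a q * f (g * (jump S q)⁻¹) := by
        simp [F, mul_comm]
      rwa [h2] at h1
    have hF' : HasSum (fun q => jumpProb a q * f (g * (jump S q)⁻¹))
        (average (jumpProb a) (jump S) f g) := by
      refine havg.congr_fun fun q => ?_
      rw [Function.comp_apply, jumpProb_neg, jump_neg]
    have hsum : Summable (Function.uncurry F) := by
      refine (summable_prod_of_nonneg fun q => ?_).mpr ⟨fun q => (hF q).summable, ?_⟩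
      · exact mul_nonneg (hf0 _) (mul_nonneg (hp0 _) (by split_ifs <;> norm_num))
      · refine hF'.summable.congr fun q => ?_
        exact (hF q).tsum_eq.symm
    calc convPow (stepMeasure S a) (n + 1) g
        = ∑' y, ∑' q, F q y := by
          change ∑' y, convPow (stepMeasure S a) n y * stepMeasure S a (y⁻¹ * g) = _
          refine tsum_congr fun y => ?_
          rw [ih, stepMeasure_eq_tsum hk ha, ← tsum_mul_left]
      _ = ∑' q, ∑' y, F q y := (Summable.tsum_comm hsum)
      _ = walk (jumpProb a) (jump S) (n + 1) g := by
          rw [tsum_congr fun q => (hF q).tsum_eq, hF'.tsum_eq, walk]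

/-! ### The pseudo-Poincaré inequality -/

/-- The Dirichlet form of the walk. -/
noncomputable def energy (S : Fin k → G) (a : Fin k → ℝ≥0∞) (f : SqSummable G) : ℝ :=
  2 * (‖f‖ ^ 2 - inner ℝ (average (jumpProb a) (jump S) f) f)

/-- Translations by `s_i ^ l` with `|l| ≤ jumpRange (a i) r` move `f` by at most a multiple of
`√(r * energy f)`. -/
theorem exists_displacement_sq_le (hk : 1 ≤ k) (ha : ∀ i, 0 < a i) : ∃ C : ℝ, 0 < C ∧
    ∀ (f : SqSummable G) (r : ℕ), 1 ≤ r → ∀ g ∈ powerSet S (fun i => jumpRange (a i) r),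
      displacement f g ^ 2 ≤ C * r * energy S a f := by
  choose C hC hCle using fun i => exists_sq_le_mul_energy (ha i)
  have hc : ∀ i, 0 < 1 / (k : ℝ) * stepConst (a i) := fun i =>
    mul_pos (by positivity) (stepConst_pos (ha i))
  have hpos : ∀ i, 0 < C i / (1 / (k : ℝ) * stepConst (a i)) := fun i => div_pos (hC i) (hc i)
  refine ⟨∑ i, C i / (1 / (k : ℝ) * stepConst (a i)),
    Finset.sum_pos (fun i _ => hpos i) ⟨⟨0, hk⟩, Finset.mem_univ _⟩, fun f r hr g hg => ?_⟩
  obtain ⟨i, l, hl, rfl⟩ := hg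
  have hen := hasSum_energy (σ := jump S) (hasSum_jumpProb hk ha) (jumpProb_nonneg ha) f
  change HasSum _ (energy S a f) at hen
  have hen0 : 0 ≤ energy S a f :=
    hen.nonneg fun q => mul_nonneg (jumpProb_nonneg ha q) (sq_nonneg _)
  have hnat : displacement f (S i ^ l) = displacement f (S i ^ (l.natAbs : ℤ)) := by
    rcases Int.natAbs_eq l with h | h
    · rw [← h]
    · conv_lhs => rw [h, zpow_neg, displacement_inv]
  have hE : ∀ N, ∑ m ∈ Finset.range N, stepWeight (a i) m * displacement f (S i ^ (m : ℤ)) ^ 2 ≤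
      energy S a f / (1 / (k : ℝ) * stepConst (a i)) := by
    intro N
    rw [le_div_iff₀ (hc i), Finset.sum_mul]
    have h1 := sum_le_hasSum ((Finset.range N).map
      ⟨fun m : ℕ => (i, (m : ℤ)), fun m m' h => by simpa using h⟩)
      (fun q _ => mul_nonneg (jumpProb_nonneg ha q) (sq_nonneg (displacement f (jump S q)))) hen
    rw [Finset.sum_map] at h1
    refine le_trans (Finset.sum_le_sum fun m _ => le_of_eq ?_) h1
    change _ = 1 / (k : ℝ) * (stepConst (a i) * stepWeight (a i) m) *
      displacement f (S i ^ (m : ℤ)) ^ 2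
    ring
  have h2 := hCle i (fun m => displacement f (S i ^ (m : ℤ))) _ (by simp [displacement_one])
    (fun m => displacement_nonneg _)
    (fun m l => by push_cast; rw [zpow_add]; exact displacement_mul_le _ _) hE r hr l.natAbs
    (by rw [Int.abs_eq_natAbs] at hl; exact_mod_cast hl)
  rw [hnat]
  refine h2.trans ?_
  have h3 : C i / (1 / (k : ℝ) * stepConst (a i)) ≤ ∑ i, C i / (1 / (k : ℝ) * stepConst (a i)) :=
    Finset.single_le_sum (f := fun i => C i / (1 / (k : ℝ) * stepConst (a i)))
      (fun i _ => (hpos i).le) (Finset.mem_univ i)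
  calc C i * r * (energy S a f / (1 / (k : ℝ) * stepConst (a i)))
      = C i / (1 / (k : ℝ) * stepConst (a i)) * r * energy S a f := by ring
    _ ≤ _ := by gcongr

open scoped Pointwise in
/-- A Nash type inequality: if the words of length at most `M` in the powers explored in time `r`
reach many elements, the return probabilities decrease accordingly. -/
theorem exists_norm_walk_sq_le (hk : 1 ≤ k) (ha : ∀ i, 0 < a i) (M : ℕ) : ∃ K : ℝ, 0 < K ∧
    ∀ (n r : ℕ), 1 ≤ r → ∀ U : Finset G, U.Nonempty →
      (∀ x ∈ U, x ∈ powerSet S (fun i => jumpRange (a i) r) ^ M) →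
      ‖walk (jumpProb a) (jump S) n‖ ^ 2 ≤ K * r * (‖walk (jumpProb a) (jump S) n‖ ^ 2 -
        ‖walk (jumpProb a) (jump S) (n + 1)‖ ^ 2) + 1 / U.card := by
  obtain ⟨C, hC, hCle⟩ := exists_displacement_sq_le (S := S) hk ha
  have hp := hasSum_jumpProb hk ha
  have hp0 := jumpProb_nonneg ha
  -- the trivial jump `s_i ^ 0`
  set q₀ : Fin k × ℤ := (⟨0, hk⟩, 0)
  have hq₀pos : 0 < jumpProb a q₀ := by
    refine mul_pos (by positivity) (mul_pos (stepConst_pos (ha _)) ?_)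
    simp [q₀, stepWeight]
  refine ⟨(M : ℝ) ^ 2 * C / jumpProb a q₀ + 1, by positivity, fun n r hr U hU hUM => ?_⟩
  set f := walk (jumpProb a) (jump S) n with hf
  have hstep : jumpProb a q₀ * energy S a f ≤
      ‖f‖ ^ 2 - ‖walk (jumpProb a) (jump S) (n + 1)‖ ^ 2 :=
    energy_le_norm_sq_sub hp hp0 (by simp [jump, q₀]) f
  have hen0 : 0 ≤ energy S a f := (hasSum_energy (σ := jump S) hp hp0 f).nonneg
    fun q => mul_nonneg (hp0 q) (sq_nonneg _)
  have hU' : ∀ g ∈ U, displacement f g ^ 2 ≤ (M : ℝ) ^ 2 * (C * r * energy S a f) := by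
    intro g hg
    have h1 := displacement_le_of_mem_pow (f := f)
      (fun g hg => Real.le_sqrt_of_sq_le (hCle f r hr g hg)) (hUM g hg)
    have h2 := pow_le_pow_left₀ (displacement_nonneg _) h1 2
    rwa [mul_pow, Real.sq_sqrt (by positivity)] at h2
  have h3 := norm_sq_le_of_displacement_le (walk_nonneg hp0 hp.summable n)
    (walk_sum_le hp hp0 n) hU hU'
  have h4 : 0 ≤ ‖f‖ ^ 2 - ‖walk (jumpProb a) (jump S) (n + 1)‖ ^ 2 :=
    le_trans (by positivity) hstep
  set D := ‖f‖ ^ 2 - ‖walk (jumpProb a) (jump S) (n + 1)‖ ^ 2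
  have h5 : energy S a f ≤ D / jumpProb a q₀ := by
    rw [le_div_iff₀ hq₀pos, mul_comm]; exact hstep
  refine h3.trans (add_le_add_left ?_ _)
  calc (M : ℝ) ^ 2 * (C * r * energy S a f) / 2 ≤ (M : ℝ) ^ 2 * (C * r * energy S a f) :=
        half_le_self (by positivity)
    _ ≤ (M : ℝ) ^ 2 * (C * r * (D / jumpProb a q₀)) := by gcongr
    _ = (M : ℝ) ^ 2 * C / jumpProb a q₀ * r * D := by ring
    _ ≤ _ := by gcongr; linarith

end Walk

/-! ### From the Nash type inequality to decay -/

/-- Summing the inequality over `n / 2 ≤ m < n` bounds `u n` by a small multiple of `u (n / 2)`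
plus the desired bound; iterate. -/
theorem exists_le_div_of_nash {u V : ℕ → ℝ} {K : ℝ} (hK : 0 < K) (hu : Antitone u)
    (hu0 : ∀ n, 0 ≤ u n) (hV : ∀ n, 1 ≤ n → 0 < V n)
    (hVd : ∀ q : ℕ, ∃ A : ℝ, 0 < A ∧ ∀ m n : ℕ, 1 ≤ m → 1 ≤ n → n ≤ q * m → V n ≤ A * V m)
    (h : ∀ n r : ℕ, 1 ≤ r → u n ≤ K * r * (u n - u (n + 1)) + 1 / V r) :
    ∃ C : ℝ, 0 < C ∧ ∀ n, 1 ≤ n → u n ≤ C / V n := by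
  obtain ⟨A, hA, hVA⟩ := hVd 3
  -- with `r = n / Q`, the coefficient of `u (n / 2)` is at most `2 * K / Q ≤ 1 / (2 * A)`
  obtain ⟨Q, hQ⟩ := exists_nat_ge (4 * K * A + 2)
  have hQ2 : 2 ≤ Q := by
    have : (2 : ℝ) ≤ Q := by nlinarith [mul_pos hK hA]
    exact_mod_cast this
  have hQ0 : (0 : ℝ) < Q := by positivity
  obtain ⟨B, hB, hVB⟩ := hVd (2 * Q)
  have hsmall : ∀ n ∈ Finset.range Q, 0 ≤ |u n * V n| := fun n _ => abs_nonneg _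
  refine ⟨2 * B + ∑ n ∈ Finset.range Q, |u n * V n|,
    add_pos_of_pos_of_nonneg (by positivity) (Finset.sum_nonneg hsmall), fun n hn => ?_⟩
  set C := 2 * B + ∑ n ∈ Finset.range Q, |u n * V n| with hC
  have hCB : 2 * B ≤ C := le_add_of_nonneg_right (Finset.sum_nonneg hsmall)
  induction n using Nat.strong_induction_on with
  | _ n ih =>
    rw [le_div_iff₀ (hV n hn)]
    rcases lt_or_ge n Q with hnQ | hnQ
    · have := Finset.single_le_sum hsmall (Finset.mem_range.mpr hnQ)
      linarith [le_abs_self (u n * V n)]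
    have hh1 : 1 ≤ n / 2 := by omega
    have hr1 : 1 ≤ n / Q := (Nat.one_le_div_iff (by omega)).mpr hnQ
    have ihn := ih (n / 2) (by omega) hh1
    rw [le_div_iff₀ (hV _ hh1)] at ihn
    -- telescoping sum over `n / 2 ≤ m < n`
    have htel : ((n - n / 2 : ℕ) : ℝ) * u n ≤
        K * (n / Q : ℕ) * u (n / 2) + ((n - n / 2 : ℕ) : ℝ) * (1 / V (n / Q)) := by
      have h1 : ∀ m ∈ Finset.Ico (n / 2) n,
          u n ≤ K * (n / Q : ℕ) * (u m - u (m + 1)) + 1 / V (n / Q) := fun m hm =>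
        (hu (Finset.mem_Ico.mp hm).2.le).trans (h m _ hr1)
      have h2 := Finset.sum_le_sum h1
      rw [Finset.sum_const, Nat.card_Ico, nsmul_eq_mul, Finset.sum_add_distrib, ← Finset.mul_sum,
        Finset.sum_const, Nat.card_Ico, nsmul_eq_mul] at h2
      have h3 : ∑ m ∈ Finset.Ico (n / 2) n, (u m - u (m + 1)) = u (n / 2) - u n := by
        have := Finset.sum_Ico_sub u (show n / 2 ≤ n by omega)
        rw [← neg_inj, ← Finset.sum_neg_distrib, neg_sub, ← this]
        exact Finset.sum_congr rfl fun m _ => by ring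
      rw [h3] at h2
      have h4 : K * (n / Q : ℕ) * (u (n / 2) - u n) ≤ K * (n / Q : ℕ) * u (n / 2) :=
        mul_le_mul_of_nonneg_left (by linarith [hu0 n]) (by positivity)
      linarith
    have hhalf : (n : ℝ) ≤ 2 * ((n - n / 2 : ℕ) : ℝ) := by
      exact_mod_cast (show n ≤ 2 * (n - n / 2) by omega)
    have hrQ : ((n / Q : ℕ) : ℝ) * Q ≤ n := by exact_mod_cast Nat.div_mul_le_self n Q
    have hV2 := hVA (n / 2) n hh1 hn (by omega)
    have hVQ := hVB (n / Q) n hr1 hn (by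
      have := Nat.lt_div_mul_add (a := n) (b := Q) (by omega)
      nlinarith)
    have hVr := hV _ hr1
    have hn0 : (0 : ℝ) < ((n - n / 2 : ℕ) : ℝ) := by
      exact_mod_cast (show 0 < n - n / 2 by omega)
    set N : ℝ := ((n - n / 2 : ℕ) : ℝ)
    have hVn := hV n hn
    have h5 : 1 / V (n / Q) * V n ≤ B := by
      rw [one_div, inv_mul_le_iff₀ hVr, mul_comm]; exact hVQ
    have h6 : u (n / 2) * V n ≤ A * C := by
      calc u (n / 2) * V n ≤ u (n / 2) * (A * V (n / 2)) :=
            mul_le_mul_of_nonneg_left hV2 (hu0 _)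
        _ = A * (u (n / 2) * V (n / 2)) := by ring
        _ ≤ A * C := by gcongr
    have h7 : K * (n / Q : ℕ) * A ≤ N / 2 := by
      have : K * A * 4 * ((n / Q : ℕ) : ℝ) ≤ Q * ((n / Q : ℕ) : ℝ) :=
        mul_le_mul_of_nonneg_right (by linarith) (by positivity)
      linarith
    have hC0 : 0 ≤ C := by linarith
    refine le_of_mul_le_mul_left ?_ hn0
    calc N * (u n * V n) = N * u n * V n := by ring
      _ ≤ (K * (n / Q : ℕ) * u (n / 2) + N * (1 / V (n / Q))) * V n := by gcongr
      _ = K * (n / Q : ℕ) * (u (n / 2) * V n) + N * (1 / V (n / Q) * V n) := by ring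
      _ ≤ K * (n / Q : ℕ) * (A * C) + N * B := by gcongr
      _ = K * (n / Q : ℕ) * A * C + N * B := by ring
      _ ≤ N / 2 * C + N * B := by gcongr
      _ ≤ N * C := by nlinarith

/-! ### Return probabilities and weight systems -/

section Main

variable {G : Type*} [Group G] {k : ℕ} {S : Fin k → G} {a : Fin k → ℝ≥0∞}
  {Γ : Type*} [AddCommGroup Γ] {w : Fin k → Γ}

theorem map_weight_nonneg {φ : Γ →+ ℝ} (hφ : ∀ i, 0 ≤ φ (w i)) (c : FormalComm k) :
    0 ≤ φ (c.weight w) := by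
  induction c with
  | letter i ε => exact hφ i
  | bracket c₁ c₂ h₁ h₂ => rw [FormalComm.weight, map_add]; exact add_nonneg h₁ h₂

/-- The size of a formal commutator is controlled by its weight. -/
theorem rpow_weight_le_size {φ₁ φ₂ : Γ →+ ℝ} {x y : ℝ} (hx : 0 < x) (hy : 0 < y) {R : Fin k → ℕ}
    (hR : ∀ i, x ^ φ₁ (w i) * y ^ φ₂ (w i) ≤ R i) (c : FormalComm k) :
    x ^ φ₁ (c.weight w) * y ^ φ₂ (c.weight w) ≤ c.size R := by
  induction c with
  | letter i ε => exact hR i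
  | bracket c₁ c₂ h₁ h₂ =>
    simp only [FormalComm.weight, FormalComm.size, map_add, Real.rpow_add hx, Real.rpow_add hy]
    push_cast
    calc _ = x ^ φ₁ (c₁.weight w) * y ^ φ₂ (c₁.weight w) *
          (x ^ φ₁ (c₂.weight w) * y ^ φ₂ (c₂.weight w)) := by ring
      _ ≤ _ := by gcongr

variable [LinearOrder Γ] [IsOrderedAddMonoid Γ]

theorem exponent_nonneg (hS : Subgroup.closure (Set.range S) = ⊤) (hk : 1 ≤ k)
    (hw : ∀ i, 0 < w i) {φ : Γ →+ ℝ} (hφ : ∀ i, 0 ≤ φ (w i)) : 0 ≤ exponent hS hw φ := by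
  refine Finset.sum_nonneg fun h _ => mul_nonneg ?_ (Nat.cast_nonneg _)
  obtain ⟨c, hc⟩ := wbar_mem_range hk hw h
  rw [← hc]
  exact map_weight_nonneg hφ c

/-- The function `n ^ D₁ * (log (e + n)) ^ D₂` is doubling. -/
theorem exists_rpow_mul_log_le {D₁ D₂ : ℝ} (h₁ : 0 ≤ D₁) (h₂ : 0 ≤ D₂) (q : ℕ) :
    ∃ A : ℝ, 0 < A ∧ ∀ m n : ℕ, 1 ≤ m → 1 ≤ n → n ≤ q * m →
      (n : ℝ) ^ D₁ * Real.log (Real.exp 1 + n) ^ D₂ ≤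
        A * ((m : ℝ) ^ D₁ * Real.log (Real.exp 1 + m) ^ D₂) := by
  have hlq : 0 ≤ Real.log ((q : ℝ) + 1) := Real.log_nonneg (by linarith [q.cast_nonneg (α := ℝ)])
  refine ⟨((q : ℝ) + 1) ^ D₁ * (Real.log (q + 1) + 1) ^ D₂, by positivity,
    fun m n hm hn hnm => ?_⟩
  have hqm : (n : ℝ) ≤ q * m := by exact_mod_cast hnm
  have hm0 : (0 : ℝ) ≤ m := m.cast_nonneg
  have hq0 : (0 : ℝ) ≤ q := q.cast_nonneg
  have hLm := one_le_log_exp_one_add m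
  have hLn := one_le_log_exp_one_add n
  have hL : Real.log (Real.exp 1 + n) ≤ (Real.log (q + 1) + 1) * Real.log (Real.exp 1 + m) := by
    have he := Real.exp_pos 1
    calc Real.log (Real.exp 1 + n) ≤ Real.log ((q + 1) * (Real.exp 1 + m)) :=
          Real.log_le_log (by positivity) (by nlinarith)
      _ = Real.log (q + 1) + Real.log (Real.exp 1 + m) :=
          Real.log_mul (by positivity) (by positivity)
      _ ≤ _ := by nlinarith
  calc (n : ℝ) ^ D₁ * Real.log (Real.exp 1 + n) ^ D₂
      ≤ ((q + 1) * m : ℝ) ^ D₁ *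
        ((Real.log (q + 1) + 1) * Real.log (Real.exp 1 + m)) ^ D₂ := by
        gcongr
        nlinarith
    _ = _ := by
        rw [Real.mul_rpow (by positivity) (by positivity),
          Real.mul_rpow (by positivity) (by positivity)]
        ring

/-- The return probability bound for a weight system whose weights `v` correspond to the length
scale `r ^ φ₁ v * (log (e + r)) ^ φ₂ v`, provided that the walk explores these scales. -/
theorem exists_convPow_le (hk : 1 ≤ k) (hS : Subgroup.closure (Set.range S) = ⊤)
    (ha : ∀ i, 0 < a i) (hw : ∀ i, 0 < w i) (φ₁ φ₂ : Γ →+ ℝ) (hφ₁ : ∀ i, 0 ≤ φ₁ (w i))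
    (hφ₂ : ∀ i, 0 ≤ φ₂ (w i))
    (hR : ∀ i (r : ℕ), 1 ≤ r →
      (r : ℝ) ^ φ₁ (w i) * Real.log (Real.exp 1 + r) ^ φ₂ (w i) ≤ jumpRange (a i) r) :
    ∃ C : ℝ, 0 < C ∧ ∀ n : ℕ, 1 ≤ n → convPow (stepMeasure S a) n 1 ≤
      C * (n : ℝ) ^ (-exponent hS hw φ₁) * Real.log (Real.exp 1 + n) ^ (-exponent hS hw φ₂) := by
  set D₁ := exponent hS hw φ₁ with hD₁
  set D₂ := exponent hS hw φ₂ with hD₂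
  have hD₁0 : 0 ≤ D₁ := exponent_nonneg hS hk hw hφ₁
  have hD₂0 : 0 ≤ D₂ := exponent_nonneg hS hk hw hφ₂
  have hL : ∀ n : ℕ, 0 < Real.log (Real.exp 1 + n) := fun n =>
    one_pos.trans_le (one_le_log_exp_one_add n)
  set V : ℕ → ℝ := fun n => (n : ℝ) ^ D₁ * Real.log (Real.exp 1 + n) ^ D₂ with hVdef
  have hV : ∀ n, 1 ≤ n → 0 < V n := fun n hn =>
    mul_pos (Real.rpow_pos_of_pos (by exact_mod_cast hn) _) (Real.rpow_pos_of_pos (hL n) _)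
  have hVd := exists_rpow_mul_log_le hD₁0 hD₂0
  obtain ⟨M, c, hc, hcard⟩ := exists_card_le hS hw hk (jStar S w)
  obtain ⟨K, hK, hnash⟩ := exists_norm_walk_sq_le (S := S) hk ha M
  have hp := hasSum_jumpProb hk ha
  have hp0 := jumpProb_nonneg ha
  set u : ℕ → ℝ := fun n => ‖walk (jumpProb a) (jump S) n‖ ^ 2 with hudef
  have hvol : ∀ n r : ℕ, 1 ≤ r → u n ≤ K * r * (u n - u (n + 1)) + 1 / V r := by
    intro n r hr
    have hr0 : (0 : ℝ) < r := by exact_mod_cast hr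
    obtain ⟨U, hUM, hU⟩ := hcard fun i => jumpRange (a i) r
    have hVU : V r ≤ U.card := by
      refine le_trans ?_ (Nat.cast_le.mpr hU)
      push_cast
      have hVr : V r = ∏ h ∈ Finset.range (jStar S w), ∏ _j : Fin (gradedRank hS hw h),
          (r : ℝ) ^ φ₁ (wbar w h) * Real.log (Real.exp 1 + r) ^ φ₂ (wbar w h) := by
        simp only [hVdef, hD₁, hD₂, exponent, Real.rpow_sum_of_pos hr0,
          Real.rpow_sum_of_pos (hL r), Real.rpow_mul_natCast hr0.le,
          Real.rpow_mul_natCast (hL r).le, Finset.prod_const, Finset.card_univ, Fintype.card_fin,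
          mul_pow, Finset.prod_mul_distrib]
      rw [hVr]
      have hpos : ∀ v : Γ, 0 ≤ (r : ℝ) ^ φ₁ v * Real.log (Real.exp 1 + r) ^ φ₂ v := fun v =>
        mul_nonneg (Real.rpow_nonneg hr0.le _) (Real.rpow_nonneg (hL r).le _)
      refine Finset.prod_le_prod (fun h _ => Finset.prod_nonneg fun j _ => hpos _) fun h _ =>
        Finset.prod_le_prod (fun j _ => hpos _) fun j _ => ?_
      rw [← hc h j]
      exact rpow_weight_le_size hr0 (hL r) (fun i => hR i r hr) _
    have hUne : U.Nonempty := by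
      rw [← Finset.card_pos]
      exact_mod_cast (hV r hr).trans_le hVU
    exact (hnash n r hr U hUne hUM).trans
      (add_le_add_right (one_div_le_one_div_of_le (hV r hr) hVU) _)
  have hu : Antitone u := fun m n hmn =>
    pow_le_pow_left₀ (norm_nonneg _) (norm_walk_antitone hp hp0 hmn) 2
  obtain ⟨C, hC, hCle⟩ := exists_le_div_of_nash hK hu (fun n => sq_nonneg _) hV hVd hvol
  obtain ⟨A, hA, hVA⟩ := hVd 3
  have hV1 := hV 1 le_rfl
  refine ⟨C * A + V 1, by positivity, fun n hn => ?_⟩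
  have hn0 : (0 : ℝ) < n := by exact_mod_cast hn
  rw [mul_assoc, Real.rpow_neg hn0.le, Real.rpow_neg (hL n).le, ← mul_inv, ← div_eq_mul_inv,
    convPow_eq_walk hk ha]
  change _ ≤ (C * A + V 1) / V n
  rcases hn.eq_or_lt with rfl | hn2
  · have h1 : walk (jumpProb a) (jump S) 1 1 ≤ 1 := by
      simpa using walk_sum_le (σ := jump S) hp hp0 1 {1}
    refine h1.trans ?_
    rw [le_div_iff₀ hV1, one_mul]
    exact le_add_of_nonneg_left (by positivity)
  · have h2 : 1 ≤ n / 2 := by omega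
    refine (walk_one_le_norm_sq hp hp0 (jumpNeg k) jumpProb_neg jump_neg n).trans
      ((hCle _ h2).trans ?_)
    rw [div_le_div_iff₀ (hV _ h2) (hV n hn)]
    have h3 : V n ≤ A * V (n / 2) := hVA (n / 2) n h2 hn (by omega)
    nlinarith [mul_pos hV1 (hV _ h2), mul_le_mul_of_nonneg_left h3 hC.le]

end Main

end NilpotentWalk

theorem mainTheorem3 {G : Type*} [Group G] [Group.IsNilpotent G] {k : ℕ} (hk : 1 ≤ k)
    (S : Fin k → G) (hS : Subgroup.closure (Set.range S) = ⊤)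
    (a : Fin k → ℝ≥0∞) (ha : ∀ i, 0 < a i) :
    (∃ C : ℝ, 0 < C ∧ ∀ n : ℕ, 1 ≤ n →
      NilpotentWalk.convPow (NilpotentWalk.stepMeasure S a) n 1 ≤
        C * (n : ℝ) ^ (-NilpotentWalk.exponentD₁ hS ha) *
          Real.log (Real.exp 1 + n) ^ (-NilpotentWalk.exponentD₂ hS ha)) ∧
    (∃ C : ℝ, 0 < C ∧ ∀ n : ℕ, 1 ≤ n →
      NilpotentWalk.convPow (NilpotentWalk.stepMeasure S a) n 1 ≤
        C * (n : ℝ) ^ (-NilpotentWalk.exponentD hS ha)) := by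
  constructor
  · refine NilpotentWalk.exists_convPow_le hk hS ha (NilpotentWalk.logWeight_pos ha)
      ⟨⟨fun v => (ofLex v).1, rfl⟩, fun _ _ => rfl⟩ ⟨⟨fun v => (ofLex v).2, rfl⟩, fun _ _ => rfl⟩
      (fun i => one_div_nonneg.mpr (NilpotentWalk.tildeAlpha_pos (ha i)).le) (fun i => ?_)
      (fun i r _ => NilpotentWalk.le_jumpRange (a i) r)
    change (0 : ℝ) ≤ if a i = 2 then 1 / 2 else 0
    split_ifs <;> norm_num
  · obtain ⟨C, hC, h⟩ := NilpotentWalk.exists_convPow_le hk hS ha (NilpotentWalk.powerWeight_pos ha)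
      (AddMonoidHom.id ℝ) 0 (fun i => (NilpotentWalk.powerWeight_pos ha i).le) (fun i => le_rfl)
      (fun i r hr => by
        refine le_trans ?_ (NilpotentWalk.le_jumpRange (a i) r)
        refine mul_le_mul_of_nonneg_left ?_ (by positivity)
        rw [AddMonoidHom.zero_apply, Real.rpow_zero]
        exact Real.one_le_rpow (NilpotentWalk.one_le_log_exp_one_add r)
          (by split_ifs <;> norm_num))
    refine ⟨C, hC, fun n hn => (h n hn).trans_eq ?_⟩
    have h0 : NilpotentWalk.exponent hS (NilpotentWalk.powerWeight_pos ha)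
        (0 : ℝ →+ ℝ) = 0 := by
      simp [NilpotentWalk.exponent]
    rw [h0, neg_zero, Real.rpow_zero, mul_one]
    rfl
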